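/- Let $0<q<1$, $k\ge 1$, $x\in\mathbb Z$ and $\mathbf n=(n_1,\dots,n_{k+2})\in\mathbb Z^{k+2}$; $\mathbf r,\mathbf s$ range over $\mathbb Z^k$. **$q$-Bessel functions.** For $\nu\in\mathbb N$ let $$J_\nu(y;q)=y^{\nu/2}\frac{(q^{\nu+1};q)_\infty}{(q;q)_\infty}\,{}_1\varphi_1(0;q^{\nu+1};q,qy),\qquad J_{-\nu}(y;q)=(-1)^\nu q^{\nu/2}J_\nu(yq^\nu;q),$$ and for $\boldsymbol\nu=(\nu_0,\dots,\nu_{k+1})\in\mathbb Z^{k+2}$ let $$J_{\boldsymbol\nu}(\mathbf r,\mathbf s;q)=\prod_{j=1}^kJ_{\nu_j-r_{j+1}-s_{j-1}}\big(q^{r_j-r_{j+1}+s_j-s_{j-1}};q\big),\qquad s_0=\nu_0,\ r_{k+1}=\nu_{k+1}.$$ **Clebsch-Gordan coefficients.** For $m,n,x\in\mathbb N$ let $C_{x,m,n}=\bar p_{\min(m,n)}(q^{2x};q^{2|m-n|};q^2)$, where $$\bar p_n(q^x;a;q)=(-1)^{n+x}\sqrt{\frac{(aq)^{x-n}(aq;q)_\infty(aq;q)_n}{(q;q)_n(q;q)_x}}\;{}_2\varphi_1(q^{-n},0;aq;q,q^{x+1}),$$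 and let $C_{x,m,n}=0$ if one of $x,m,n\in\mathbb Z$ is negative. **Trees.** Let $(e_a)_{a\in\mathbb N}$ be the standard basis of $\ell^2(\mathbb N)$. For $a\in\mathbb N^{k+2}$ put $e_a=e_{a_1}\otimes\cdots\otimes e_{a_{k+2}}$ and $d_0=0$, $d_j=(a_j-n_j)-d_{j-1}$ for $1\le j\le k+2$. Put $r_0=x$, $r_{k+1}=n_{k+2}$, $s_0=n_1$, $s_{k+1}=x$. The right and left comb trees with root $x$, leaves $\mathbf n$ and inner nodes $\mathbf r$, respectively $\mathbf s$, are the vectors of $\ell^2(\mathbb N)^{\otimes(k+2)}$ $$\mathcal R_{\mathbf r}^{x,\mathbf n}=\sum_{a:\,d_{k+2}=0}\ \prod_{j=1}^{k+1}C_{r_{j-1}+d_{j-1},\,a_j,\,r_j+d_j}\;e_a,\qquad \mathcal L_{\mathbf s}^{x,\mathbf n}=\sum_{a:\,d_{k+2}=0}\ \prod_{j=1}^{k+1}C_{s_j+d_{j+1},\,s_{j-1}+d_j,\,a_{j+1}}\;e_a .$$ **$3nj$-symbols.** For $x\ge0$ the $3nj$-symbol is the coupling coefficient $R_{\mathbf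 r,\mathbf s}^{x,\mathbf n}=\langle\mathcal R_{\mathbf r}^{x,\mathbf n},\mathcal L_{\mathbf s}^{x,\mathbf n}\rangle$. For $x<0$ it is defined by moving the root to $0$: $R^{x,\mathbf n}_{\mathbf r,\mathbf s}=R^{0,(n_1,\,n_2+x,\dots,\,n_{k+1}+x,\,n_{k+2})}_{\mathbf r,\mathbf s}$. **Statement.** If $x\ge 0$, then $(\mathcal R_{\mathbf r}^{x,\mathbf n})_{\mathbf r\in\mathbb Z^k}$ and $(\mathcal L_{\mathbf s}^{x,\mathbf n})_{\mathbf s\in\mathbb Z^k}$ are orthonormal families in $\ell^2(\mathbb N)^{\otimes(k+2)}$, and the $3nj$-symbols are the coefficients of the (norm convergent, unconditional) expansion $$\mathcal R_{\mathbf r}^{x,\mathbf n}=\sum_{\mathbf s\in\mathbb Z^k}R_{\mathbf r,\mathbf s}^{x,\mathbf n}\,\mathcal L_{\mathbf s}^{x,\mathbf n}\qquad(\mathbf r\in\mathbb Z^k).$$ For every $x\in\mathbb Z$ they are multivariate $q$-Bessel functions: with $\boldsymbol\nu(x,\mathbf n)=(n_1,x+n_2,\dots,x+n_{k+1},n_{k+2})$,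 $$R^{x,\mathbf n}_{\mathbf r,\mathbf s}=(-q)^{r_1+s_k-n_1-n_{k+2}}\,J_{\boldsymbol\nu(x,\mathbf n)}(\mathbf r,\mathbf s;q^2)\qquad(\mathbf r,\mathbf s\in\mathbb Z^k).$$ -/

import Mathlib

noncomputable section

/-- The finite `q`-shifted factorial `(a;q)_n`. -/
def qShift (a q : ℝ) (n : ℕ) : ℝ := ∏ i ∈ Finset.range n, (1 - a * q ^ i)

/-- The infinite `q`-shifted factorial `(a;q)_∞`. -/
def qShiftInf (a q : ℝ) : ℝ := ∏' i : ℕ, (1 - a * q ^ i)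

/-- The basic hypergeometric series `₂φ₁(a, b; c; q, z)`. -/
def phi21 (a b c q z : ℝ) : ℝ :=
  ∑' i : ℕ, qShift a q i * qShift b q i / (qShift c q i * qShift q q i) * z ^ i

/-- The basic hypergeometric series `₁φ₁(a; c; q, z)`. -/
def phi11 (a c q z : ℝ) : ℝ :=
  ∑' i : ℕ, qShift a q i / (qShift c q i * qShift q q i) * ((-1) ^ i * q ^ (i.choose 2)) * z ^ i

/-- Jackson's third (Hahn-Exton) `q`-Bessel function `J_ν(y;q)` of order `ν ∈ ℕ`. -/
def qBesselNat (ν : ℕ) (y q : ℝ) : ℝ :=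
  y ^ ((ν : ℝ) / 2) * (qShiftInf (q ^ (ν + 1)) q / qShiftInf q q) * phi11 0 (q ^ (ν + 1)) q (q * y)

/-- The `q`-Bessel function `J_ν(y;q)` of integer order; for negative orders
`J_{-n}(y;q) = (-1)^n q^{n/2} J_n(y q^n;q)`. -/
def qBessel (ν : ℤ) (y q : ℝ) : ℝ :=
  if 0 ≤ ν then qBesselNat ν.toNat y q
  else (-1) ^ ν.natAbs * q ^ ((ν.natAbs : ℝ) / 2) * qBesselNat ν.natAbs (y * q ^ ν.natAbs) q

/-- The multivariate `q`-Bessel function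
`J_ν(x,l;q) = ∏_{j=1}^d J_{ν_j - x_{j+1} - l_{j-1}}(q^{x_j - x_{j+1} + l_j - l_{j-1}};q)` for
`ν = (ν_0, …, ν_{d+1})`, `x = (x_1, …, x_d)`, `l = (l_1, …, l_d)`, where `l_0 = ν_0` and
`x_{d+1} = ν_{d+1}`.  Below `X = (x_1, …, x_{d+1})` and `L = (l_0, …, l_d)`. -/
def multiQBessel {d : ℕ} (ν : Fin (d + 2) → ℤ) (x l : Fin d → ℤ) (q : ℝ) : ℝ :=
  let X : Fin (d + 1) → ℤ := Fin.snoc (α := fun _ => ℤ) x (ν (Fin.last (d + 1)))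
  let L : Fin (d + 1) → ℤ := Fin.cons (α := fun _ => ℤ) (ν 0) l
  ∏ j : Fin d,
    qBessel (ν j.succ.castSucc - X j.succ - L j.castSucc)
      (q ^ (X j.castSucc - X j.succ + L j.succ - L j.castSucc)) q

/-- The Wall polynomial `p_n(y;a;q)`. -/
def wallPoly (n : ℕ) (y a q : ℝ) : ℝ := phi21 ((q ^ n)⁻¹) 0 (a * q) q (q * y)

/-- The orthonormal Wall function `p̄_n(q^x;a;q)`. -/
def wallBar (n x : ℕ) (a q : ℝ) : ℝ :=
  (-1) ^ (n + x) *
    Real.sqrt ((a * q) ^ ((x : ℤ) - (n : ℤ)) * qShiftInf (a * q) q * qShift (a * q) q n /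
      (qShift q q n * qShift q q x)) *
    wallPoly n (q ^ x) a q

/-- The Clebsch-Gordan coefficient `C_{x,m,n} = p̄_{min(m,n)}(q^{2x};q^{2|m-n|};q²)`, which is zero
as soon as one of `x, m, n` is negative. -/
def clebschGordan (q : ℝ) (x m n : ℤ) : ℝ :=
  if 0 ≤ x ∧ 0 ≤ m ∧ 0 ≤ n then
    wallBar (min m n).toNat x.toNat ((q ^ 2) ^ (m - n).natAbs) (q ^ 2)
  else 0

/-- The Hilbert space `ℓ²(ℕ)^{⊗N}`, realised as `ℓ²(ℕ^N)`; the basis vector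
`e_{a_1} ⊗ ⋯ ⊗ e_{a_N}` corresponds to the point `a`. -/
abbrev TensorL2 (N : ℕ) : Type := lp (fun _ : Fin N → ℕ => ℂ) 2

open Classical in
/-- The vector with the given (real) coordinates; by convention `0` if they are not
square-summable. -/
def toTensorL2 {N : ℕ} (f : (Fin N → ℕ) → ℝ) : TensorL2 N :=
  if h : Memℓp (fun a => (f a : ℂ)) 2 then ⟨fun a => (f a : ℂ), h⟩ else 0

/-- The shift of the node labels of a tree with leaf labels `n_1, n_2, …` at the basis vector
`e_{a_1} ⊗ e_{a_2} ⊗ ⋯`: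
`d_0 = 0` and `d_{j+1} = (a_{j+1} - n_{j+1}) - d_j` (leaves are indexed from `0` in the code). -/
def labelShift {N : ℕ} (n : Fin N → ℤ) (a : Fin N → ℕ) : ℕ → ℤ
  | 0 => 0
  | j + 1 => (if h : j < N then (a ⟨j, h⟩ : ℤ) - n ⟨j, h⟩ else 0) - labelShift n a j

/-- Coordinates of the right comb tree with root `x`, inner nodes `r_1, …, r_k` and leaves
`n_1, …, n_{k+2}`.  Put `r_0 = x`, `r_{k+1} = n_{k+2}`.  The vector is supported on the `a` with
`∑ (-1)^j (a_j - n_j) = 0`, and its coordinate at such an `a` is the product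
`∏_{j=1}^{k+1} C_{y_{j-1}, a_j, y_j}`, where `y_0 = x`, `y_{k+1} = a_{k+2}` and the `y_j` are
determined by `y_{j-1} - a_j + y_j = r_{j-1} - n_j + r_j`, i.e. `y_j = r_j + d_j`.
For `k = 1` this is `∑ C_{x,a_1,a_1+p} C_{a_1+p,a_2,a_3} e_{a_1} ⊗ e_{a_2} ⊗ e_{a_3}` with
`p = r_1 - n_1`, the sum being over `a_1 - a_2 + a_3 = n_1 - n_2 + n_3`. -/
def rightTreeCoord {k : ℕ} (q : ℝ) (x : ℤ) (r : Fin k → ℤ) (n : Fin (k + 2) → ℤ)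
    (a : Fin (k + 2) → ℕ) : ℝ :=
  let R : Fin (k + 2) → ℤ :=
    Fin.cons (α := fun _ => ℤ) x (Fin.snoc (α := fun _ => ℤ) r (n (Fin.last (k + 1))))
  if labelShift n a (k + 2) = 0 then
    ∏ j : Fin (k + 1), clebschGordan q (R j.castSucc + labelShift n a j) (a j.castSucc)
      (R j.succ + labelShift n a (j + 1))
  else 0

/-- Coordinates of the left comb tree with root `x`, inner nodes `s_k, …, s_1` (from the root
downwards) and leaves `n_1, …, n_{k+2}`.  Put `s_0 = n_1`, `s_{k+1} = x`.  The vector is supported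
on the `a` with `∑ (-1)^j (a_j - n_j) = 0`, and its coordinate at such an `a` is the product
`∏_{j=1}^{k+1} C_{z_j, z_{j-1}, a_{j+1}}`, where `z_0 = a_1`, `z_{k+1} = x` and the `z_j` are
determined by `z_j + z_{j-1} - a_{j+1} = s_j + s_{j-1} - n_{j+1}`, i.e. `z_j = s_j + d_{j+1}`.
For `k = 1` this is `∑ C_{x,a_3-p,a_3} C_{a_3-p,a_1,a_2} e_{a_1} ⊗ e_{a_2} ⊗ e_{a_3}` with
`p = n_3 - s_1`, the sum being over `a_1 - a_2 + a_3 = n_1 - n_2 + n_3`. -/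
def leftTreeCoord {k : ℕ} (q : ℝ) (x : ℤ) (s : Fin k → ℤ) (n : Fin (k + 2) → ℤ)
    (a : Fin (k + 2) → ℕ) : ℝ :=
  let S : Fin (k + 2) → ℤ :=
    Fin.cons (α := fun _ => ℤ) (n 0) (Fin.snoc (α := fun _ => ℤ) s x)
  if labelShift n a (k + 2) = 0 then
    ∏ j : Fin (k + 1), clebschGordan q (S j.succ + labelShift n a (j + 2))
      (S j.castSucc + labelShift n a (j + 1)) (a j.succ)
  else 0

/-- The right comb tree vector. -/
def rightTree {k : ℕ} (q : ℝ) (x : ℤ) (r : Fin k → ℤ) (n : Fin (k + 2) → ℤ) :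
    TensorL2 (k + 2) :=
  toTensorL2 (rightTreeCoord q x r n)

/-- The left comb tree vector. -/
def leftTree {k : ℕ} (q : ℝ) (x : ℤ) (s : Fin k → ℤ) (n : Fin (k + 2) → ℤ) :
    TensorL2 (k + 2) :=
  toTensorL2 (leftTreeCoord q x s n)

/-- The labels `(n_1, n_2 + t, …, n_{k+1} + t, n_{k+2})`. -/
def shiftMiddle {k : ℕ} (n : Fin (k + 2) → ℤ) (t : ℤ) : Fin (k + 2) → ℤ :=
  fun j => if j = 0 ∨ j = Fin.last (k + 1) then n j else n j + t

/-- The `3nj`-symbol `R_{r,s}^{x,n}`: the coupling coefficient between the right comb tree with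
inner nodes `r` and the left comb tree with inner nodes `s`, both with root `x` and leaves `n`.
If `x ≥ 0` then `max x 0 = x` and `min x 0 = 0`, and this is literally the inner product of the two
tree vectors.  If `x < 0` there are no tree vectors with root `x`, and the symbol is extended, as
the `6j`-symbols are, through its invariance under
`(x, n_2, …, n_{k+1}) ↦ (x + t, n_2 - t, …, n_{k+1} - t)`: the root is moved to `0`. -/
def threeNJ {k : ℕ} (q : ℝ) (x : ℤ) (n : Fin (k + 2) → ℤ) (r s : Fin k → ℤ) : ℂ :=
  inner ℂ (leftTree q (max x 0) s (shiftMiddle n (min x 0)))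
    (rightTree q (max x 0) r (shiftMiddle n (min x 0)))

end

open Filter Topology

/-! ### Shifted factorials and Euler's two expansions. -/

section QSeries

variable {q : ℝ}

/-! The passage from the right comb to the left comb is a chain of rotations, each involving two
neighbouring vertices. One rotation is the recoupling formula C_{x,z,y} C_{y,b,w} = Σ_t K(x+b-w-z,
y-w+t-z) C_{x,t,w} C_{t,z,b}, with K(N,e) = (-q)^e J_N(q^{2e};q²) (`recoupling`). Iterating it from
the root gives the product of `q`-Bessel functions, and the powers of `-q` telescope.

The recoupling formula rests on four contiguous relations of the Clebsch-Gordan coefficients, which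
express intertwining with the generators α, α*, γ, γ* of quantum SU(2). They come from a form of the
Wall function that is symmetric in m and n (`clebschGordan_eq`). The two arguments of K are constant
along every induction step (on x, then z, then b and w together), so K factors out and only
relations among Clebsch-Gordan coefficients are used. No recurrence for Bessel functions is needed;
they enter in the base case alone, a generating function that follows from Euler's expansions
(`hasSum_besselSeries`).

Orthonormality of the coefficients follows from the same relations, since α* and α act as adjoints
on the root label (`hasSum_clebschGordan_mul`). Peeling a comb at its root carries it over to trees
(`hasSum_combCoord_mul`).

At a basis point a, the node labels of both trees are shifted by the d_j. The kernel arguments are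
invariant under this shift, so the coefficients do not depend on a and the scalar expansions
assemble into one of vectors. The kernel is absolutely summable with bounds uniform in the order
(`exists_besselKernel_bound`), which gives norm convergence. Orthonormality of the left trees then
identifies the coefficients with the inner products; completeness is not used. Finally x enters only
through x + n_j, which settles negative x. -/

lemma qShift_zero (a q : ℝ) : qShift a q 0 = 1 := by simp [qShift]

lemma qShift_succ (a q : ℝ) (n : ℕ) : qShift a q (n + 1) = qShift a q n * (1 - a * q ^ n) := by
  simp [qShift, Finset.prod_range_succ]

lemma qShift_self_succ (q : ℝ) (n : ℕ) :
    qShift q q (n + 1) = qShift q q n * (1 - q ^ (n + 1)) := by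
  rw [qShift_succ, pow_succ']

lemma qShift_add (a q : ℝ) (m n : ℕ) :
    qShift a q (m + n) = qShift a q m * qShift (a * q ^ m) q n := by
  simp only [qShift, Finset.prod_range_add]
  congr 1
  refine Finset.prod_congr rfl fun i _ => ?_
  rw [pow_add]; ring

lemma qShift_zero_left (q : ℝ) (n : ℕ) : qShift 0 q n = 1 := by simp [qShift]

lemma one_sub_pow_pos (hq0 : 0 < q) (hq1 : q < 1) {n : ℕ} (hn : n ≠ 0) : 0 < 1 - q ^ n :=
  sub_pos.2 (pow_lt_one₀ hq0.le hq1 hn)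

lemma qShift_self_pos (hq0 : 0 < q) (hq1 : q < 1) (n : ℕ) : 0 < qShift q q n := by
  refine Finset.prod_pos fun i _ => ?_
  rw [← pow_succ']
  exact one_sub_pow_pos hq0 hq1 i.succ_ne_zero

lemma qShift_pow_pos (hq0 : 0 < q) (hq1 : q < 1) (m n : ℕ) : 0 < qShift (q ^ (m + 1)) q n := by
  refine Finset.prod_pos fun i _ => ?_
  rw [← pow_add]
  exact one_sub_pow_pos hq0 hq1 (by omega)

lemma multipliable_qShift (hq0 : 0 < q) (hq1 : q < 1) (a : ℝ) :
    Multipliable fun i : ℕ => 1 - a * q ^ i := by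
  have h : Summable fun i : ℕ => ‖-(a * q ^ i)‖ := by
    simp only [norm_neg, norm_mul, norm_pow, Real.norm_of_nonneg hq0.le]
    exact (summable_geometric_of_lt_one hq0.le hq1).mul_left _
  simpa [sub_eq_add_neg] using multipliable_one_add_of_summable h

lemma tendsto_qShift (hq0 : 0 < q) (hq1 : q < 1) (a : ℝ) :
    Tendsto (fun n => qShift a q n) atTop (𝓝 (qShiftInf a q)) :=
  (multipliable_qShift hq0 hq1 a).tendsto_prod_tprod_nat

lemma qShiftInf_eq_mul (hq0 : 0 < q) (hq1 : q < 1) (a : ℝ) (n : ℕ) :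
    qShiftInf a q = qShift a q n * qShiftInf (a * q ^ n) q := by
  have h := tendsto_qShift hq0 hq1 a
  rw [← tendsto_add_atTop_iff_nat n] at h
  refine tendsto_nhds_unique h ?_
  simp only [add_comm _ n, qShift_add]
  exact (tendsto_qShift hq0 hq1 _).const_mul _

/-- Ends both Euler expansions: iterating the functional equation relating f(w) and f(wq) leaves the
limit of f(z q^k), which is the constant coefficient. -/
lemma tendsto_tsum_coeff_zero {c : ℕ → ℝ} {z : ℝ} (hq0 : 0 < q) (hq1 : q < 1)
    (hs : Summable fun n => ‖c n * z ^ n‖) :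
    Tendsto (fun k => ∑' n, c n * (z * q ^ k) ^ n) atTop (𝓝 (c 0)) := by
  have h : Tendsto (fun k => ∑' n, c n * (z * q ^ k) ^ n) atTop
      (𝓝 (∑' n, if n = 0 then c 0 else 0)) := by
    refine tendsto_tsum_of_dominated_convergence hs (fun n => ?_) (Eventually.of_forall ?_)
    · rcases Nat.eq_zero_or_pos n with rfl | hn
      · simp
      · have h1 : Tendsto (fun k : ℕ => z * q ^ k) atTop (𝓝 (z * 0)) :=
          (tendsto_pow_atTop_nhds_zero_of_lt_one hq0.le hq1).const_mul z
        have h2 := (h1.pow n).const_mul (c n)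
        simpa [hn.ne'] using h2
    · intro k n
      simp only [norm_mul, norm_pow, Real.norm_of_nonneg hq0.le, mul_pow]
      have h1 : (q ^ k) ^ n ≤ 1 := pow_le_one₀ (by positivity) (pow_le_one₀ hq0.le hq1.le)
      calc ‖c n‖ * (‖z‖ ^ n * (q ^ k) ^ n) ≤ ‖c n‖ * (‖z‖ ^ n * 1) := by gcongr
        _ = _ := by rw [mul_one]
  simpa using h

lemma summable_euler_one (hq0 : 0 < q) (hq1 : q < 1) {z : ℝ} (hz : |z| < 1) :
    Summable fun n => ‖(qShift q q n)⁻¹ * z ^ n‖ := by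
  rcases eq_or_ne z 0 with rfl | hz0
  · refine summable_of_ne_finset_zero (s := {0}) fun n hn => ?_
    simp only [Finset.mem_singleton] at hn
    simp [hn]
  refine (summable_of_ratio_test_tendsto_lt_one (l := |z|) hz
    (Eventually.of_forall fun n => mul_ne_zero (inv_ne_zero (qShift_self_pos hq0 hq1 n).ne')
      (pow_ne_zero _ hz0)) ?_).norm
  have h : Tendsto (fun n : ℕ => |z| / (1 - q * q ^ n)) atTop (𝓝 (|z| / (1 - q * 0))) :=
    tendsto_const_nhds.div (tendsto_const_nhds.sub
      ((tendsto_pow_atTop_nhds_zero_of_lt_one hq0.le hq1).const_mul q)) (by simp)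
  simp only [mul_zero, sub_zero, div_one] at h
  refine h.congr fun n => ?_
  have h1 := qShift_self_pos hq0 hq1 n
  have h2 := one_sub_pow_pos hq0 hq1 n.succ_ne_zero
  have h3 : |z| ≠ 0 := abs_ne_zero.2 hz0
  rw [qShift_self_succ, norm_mul, norm_mul, norm_inv, norm_inv, norm_pow, norm_pow, norm_mul,
    Real.norm_of_nonneg h1.le, Real.norm_of_nonneg h2.le, Real.norm_eq_abs, ← pow_succ']
  field_simp
  ring

/-- Euler's expansion of `1 / (z;q)_∞`. -/
theorem tsum_euler_one (hq0 : 0 < q) (hq1 : q < 1) {z : ℝ} (hz : |z| < 1) :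
    qShiftInf z q * ∑' n, (qShift q q n)⁻¹ * z ^ n = 1 := by
  have hstep : ∀ w : ℝ, |w| < 1 →
      ∑' n, (qShift q q n)⁻¹ * (w * q) ^ n = (1 - w) * ∑' n, (qShift q q n)⁻¹ * w ^ n := by
    intro w hw
    have hs := (summable_euler_one hq0 hq1 hw).of_norm
    have hw' : |w * q| < 1 := by
      rw [abs_mul, abs_of_pos hq0]
      nlinarith [abs_nonneg w]
    have hs' := (summable_euler_one hq0 hq1 hw').of_norm
    have h1 : ∑' n, (qShift q q n)⁻¹ * w ^ n - ∑' n, (qShift q q n)⁻¹ * (w * q) ^ n =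
        w * ∑' n, (qShift q q n)⁻¹ * w ^ n := by
      rw [← hs.tsum_sub hs', (hs.sub hs').tsum_eq_zero_add, ← tsum_mul_left]
      simp only [pow_zero, mul_one, sub_self, zero_add]
      refine tsum_congr fun n => ?_
      have h1 := (qShift_self_pos hq0 hq1 n).ne'
      have h2 := (one_sub_pow_pos hq0 hq1 n.succ_ne_zero).ne'
      rw [qShift_self_succ, mul_pow]
      field_simp
      ring
    linarith
  have hiter : ∀ k, ∑' n, (qShift q q n)⁻¹ * (z * q ^ k) ^ n =
      qShift z q k * ∑' n, (qShift q q n)⁻¹ * z ^ n := by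
    intro k
    induction k with
    | zero => simp [qShift_zero]
    | succ k ih =>
      have hzk : |z * q ^ k| < 1 := by
        rw [abs_mul, abs_of_pos (pow_pos hq0 k)]
        have := pow_le_one₀ (n := k) hq0.le hq1.le
        have := pow_pos hq0 k
        nlinarith [abs_nonneg z]
      rw [pow_succ, ← mul_assoc, hstep _ hzk, ih, qShift_succ]
      ring
  have h1 := tendsto_tsum_coeff_zero hq0 hq1 (summable_euler_one hq0 hq1 hz)
  simp only [hiter, qShift_zero, inv_one] at h1
  exact tendsto_nhds_unique ((tendsto_qShift hq0 hq1 z).mul_const _) h1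

lemma qShiftInf_pow_pos (hq0 : 0 < q) (hq1 : q < 1) (n : ℕ) : 0 < qShiftInf (q ^ (n + 1)) q := by
  have h1 : 0 ≤ qShiftInf (q ^ (n + 1)) q :=
    ge_of_tendsto' (tendsto_qShift hq0 hq1 _) fun k => (qShift_pow_pos hq0 hq1 n k).le
  refine h1.lt_of_ne' fun h => ?_
  -- Euler's identity exhibits an inverse of the infinite product, so a limit of positive numbers
  -- cannot be zero here.
  have h2 := tsum_euler_one hq0 hq1 (z := q ^ (n + 1)) (by
    rw [abs_of_pos (by positivity)]
    exact pow_lt_one₀ hq0.le hq1 n.succ_ne_zero)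
  simp [h] at h2

lemma qShiftInf_self_pos (hq0 : 0 < q) (hq1 : q < 1) : 0 < qShiftInf q q := by
  simpa using qShiftInf_pow_pos hq0 hq1 0

lemma qShiftInf_self_eq (hq0 : 0 < q) (hq1 : q < 1) (n : ℕ) :
    qShiftInf q q = qShift q q n * qShiftInf (q ^ (n + 1)) q := by
  rw [qShiftInf_eq_mul hq0 hq1 q n, pow_succ']

lemma qShiftInf_pow_le_one (hq0 : 0 < q) (hq1 : q < 1) (n : ℕ) :
    qShiftInf (q ^ (n + 1)) q ≤ 1 := by
  refine le_of_tendsto' (tendsto_qShift hq0 hq1 _) fun k => ?_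
  refine Finset.prod_le_one (fun i _ => ?_) fun i _ => ?_
  · rw [← pow_add]
    exact (one_sub_pow_pos hq0 hq1 (by omega)).le
  · have : 0 ≤ q ^ (n + 1) * q ^ i := by positivity
    linarith

lemma qShiftInf_self_le_qShift (hq0 : 0 < q) (hq1 : q < 1) (n : ℕ) :
    qShiftInf q q ≤ qShift q q n := by
  rw [qShiftInf_self_eq hq0 hq1 n]
  exact mul_le_of_le_one_right (qShift_self_pos hq0 hq1 n).le (qShiftInf_pow_le_one hq0 hq1 n)

/-- The infinite product `(q^e;q)_∞` vanishes for integers `e ≤ 0`. -/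
lemma qShiftInf_zpow_eq_zero (hq0 : 0 < q) {e : ℤ} (he : e ≤ 0) : qShiftInf (q ^ e) q = 0 := by
  refine tprod_of_exists_eq_zero ⟨(-e).toNat, ?_⟩
  have h : ((-e).toNat : ℤ) = -e := Int.toNat_of_nonneg (by omega)
  rw [← zpow_natCast, ← zpow_add₀ hq0.ne', h]
  simp

lemma summable_pow_choose_two (hq0 : 0 < q) (hq1 : q < 1) (z : ℝ) :
    Summable fun n : ℕ => q ^ n.choose 2 * |z| ^ n := by
  have h : Summable fun n : ℕ => q ^ n.choose 2 * (|z| + 1) ^ n := by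
    refine summable_of_ratio_test_tendsto_lt_one (l := 0) one_pos
      (Eventually.of_forall fun n => by positivity) ?_
    have h : Tendsto (fun n : ℕ => q ^ n * (|z| + 1)) atTop (𝓝 (0 * (|z| + 1))) :=
      (tendsto_pow_atTop_nhds_zero_of_lt_one hq0.le hq1).mul_const _
    rw [zero_mul] at h
    refine h.congr fun n => ?_
    have hc : (n + 1).choose 2 = n + n.choose 2 := by simp [Nat.choose_succ_succ' n 1]
    rw [Real.norm_of_nonneg (by positivity), Real.norm_of_nonneg (by positivity), hc, pow_add,
      pow_succ]
    field_simp
  refine h.of_nonneg_of_le (fun n => by positivity) fun n => ?_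
  gcongr
  linarith

lemma abs_euler_two_le (hq0 : 0 < q) (hq1 : q < 1) (z : ℝ) (n : ℕ) :
    ‖(-1) ^ n * q ^ n.choose 2 * (qShift q q n)⁻¹ * z ^ n‖ ≤
      (qShiftInf q q)⁻¹ * (q ^ n.choose 2 * |z| ^ n) := by
  have h1 := qShift_self_pos hq0 hq1 n
  have h3 := qShiftInf_self_pos hq0 hq1
  have h2 := inv_anti₀ h3 (qShiftInf_self_le_qShift hq0 hq1 n)
  simp only [norm_mul, norm_pow, norm_neg, norm_one, one_pow, one_mul,
    Real.norm_of_nonneg hq0.le, norm_inv, Real.norm_of_nonneg h1.le, Real.norm_eq_abs]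
  calc q ^ n.choose 2 * (qShift q q n)⁻¹ * |z| ^ n
      ≤ q ^ n.choose 2 * (qShiftInf q q)⁻¹ * |z| ^ n := by gcongr
    _ = _ := by ring

lemma summable_euler_two (hq0 : 0 < q) (hq1 : q < 1) (z : ℝ) :
    Summable fun n : ℕ => ‖(-1) ^ n * q ^ n.choose 2 * (qShift q q n)⁻¹ * z ^ n‖ :=
  ((summable_pow_choose_two hq0 hq1 z).mul_left _).of_nonneg_of_le (fun _ => norm_nonneg _)
    (abs_euler_two_le hq0 hq1 z)

/-- Euler's expansion of `(z;q)_∞`. -/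
theorem hasSum_euler_two (hq0 : 0 < q) (hq1 : q < 1) (z : ℝ) :
    HasSum (fun n : ℕ => (-1) ^ n * q ^ n.choose 2 * (qShift q q n)⁻¹ * z ^ n) (qShiftInf z q) := by
  have hstep : ∀ w : ℝ,
      ∑' n : ℕ, (-1) ^ n * q ^ n.choose 2 * (qShift q q n)⁻¹ * w ^ n =
        (1 - w) * ∑' n : ℕ, (-1) ^ n * q ^ n.choose 2 * (qShift q q n)⁻¹ * (w * q) ^ n := by
    intro w
    have hs := (summable_euler_two hq0 hq1 w).of_norm
    have hs' := (summable_euler_two hq0 hq1 (w * q)).of_norm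
    have h1 : ∑' n : ℕ, (-1) ^ n * q ^ n.choose 2 * (qShift q q n)⁻¹ * w ^ n -
        ∑' n : ℕ, (-1) ^ n * q ^ n.choose 2 * (qShift q q n)⁻¹ * (w * q) ^ n =
        (-w) * ∑' n : ℕ, (-1) ^ n * q ^ n.choose 2 * (qShift q q n)⁻¹ * (w * q) ^ n := by
      rw [← hs.tsum_sub hs', (hs.sub hs').tsum_eq_zero_add, ← tsum_mul_left]
      simp only [pow_zero, mul_one, sub_self, zero_add]
      refine tsum_congr fun n => ?_
      have h1 := (qShift_self_pos hq0 hq1 n).ne'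
      have h2 := (one_sub_pow_pos hq0 hq1 n.succ_ne_zero).ne'
      have hc : (n + 1).choose 2 = n + n.choose 2 := by simp [Nat.choose_succ_succ' n 1]
      rw [qShift_self_succ, mul_pow, mul_pow, hc, pow_add q n]
      field_simp
      ring
    linarith
  have hiter : ∀ k, ∑' n : ℕ, (-1) ^ n * q ^ n.choose 2 * (qShift q q n)⁻¹ * z ^ n =
      qShift z q k *
        ∑' n : ℕ, (-1) ^ n * q ^ n.choose 2 * (qShift q q n)⁻¹ * (z * q ^ k) ^ n := by
    intro k
    induction k with
    | zero => simp [qShift_zero]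
    | succ k ih =>
      rw [ih, hstep (z * q ^ k), qShift_succ, pow_succ]
      ring_nf
  have h1 := tendsto_tsum_coeff_zero hq0 hq1 (summable_euler_two hq0 hq1 z)
  have h2 := (tendsto_qShift hq0 hq1 z).mul h1
  simp only [← hiter] at h2
  have h3 := tendsto_nhds_unique h2 tendsto_const_nhds
  simp only [pow_zero, Nat.choose_zero_succ, qShift_zero, inv_one, mul_one] at h3
  rw [h3]
  exact (summable_euler_two hq0 hq1 z).of_norm.hasSum

end QSeries

/-! ### The symmetric series behind the Wall functions and its contiguous relations. -/

section WallSeries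

variable {Q : ℝ}

/-- The falling `Q`-factorial `(1 - Q^m)(1 - Q^{m-1}) ⋯ (1 - Q^{m-l+1})`. -/
noncomputable def qFalling (Q : ℝ) (l : ℕ) (m : ℤ) : ℝ := ∏ i ∈ Finset.range l, (1 - Q ^ (m - i))

lemma qFalling_zero (Q : ℝ) (m : ℤ) : qFalling Q 0 m = 1 := by simp [qFalling]

lemma qFalling_succ (Q : ℝ) (l : ℕ) (m : ℤ) :
    qFalling Q (l + 1) m = qFalling Q l m * (1 - Q ^ (m - l)) := by
  simp [qFalling, Finset.prod_range_succ]

lemma qFalling_succ' (Q : ℝ) (l : ℕ) (m : ℤ) :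
    qFalling Q (l + 1) m = (1 - Q ^ m) * qFalling Q l (m - 1) := by
  rw [qFalling, Finset.prod_range_succ', mul_comm]
  simp only [qFalling, Nat.cast_zero, sub_zero]
  congr 1
  refine Finset.prod_congr rfl fun i _ => ?_
  congr 2
  push_cast
  ring

lemma qFalling_eq_zero (Q : ℝ) {l : ℕ} {m : ℕ} (h : m < l) : qFalling Q l (m : ℤ) = 0 :=
  Finset.prod_eq_zero (Finset.mem_range.2 h) (by simp)

lemma qFalling_mul_qShift (Q : ℝ) (l i : ℕ) :
    qFalling Q l ((i + l : ℕ) : ℤ) * qShift Q Q i = qShift Q Q (i + l) := by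
  induction l with
  | zero => simp [qFalling_zero]
  | succ l ih =>
    rw [qFalling_succ', show ((i + (l + 1) : ℕ) : ℤ) - 1 = ((i + l : ℕ) : ℤ) by push_cast; ring,
      mul_assoc, ih, ← add_assoc, qShift_self_succ, zpow_natCast]
    ring

/-- The `l`-th term of the symmetric series of the Clebsch-Gordan coefficients. -/
noncomputable def wallTerm (Q : ℝ) (x m n : ℤ) (l : ℕ) : ℝ :=
  (-1) ^ l * Q ^ l.choose 2 * Q ^ (-(l * x)) * qFalling Q l m * qFalling Q l n / qShift Q Q l

/-- The symmetric series of the Clebsch-Gordan coefficients, truncated after `K` terms. -/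
noncomputable def wallSum (Q : ℝ) (K : ℕ) (x m n : ℤ) : ℝ := ∑ l ∈ Finset.range K, wallTerm Q x m n l

lemma wallTerm_zero (Q : ℝ) (x m n : ℤ) : wallTerm Q x m n 0 = 1 := by
  simp [wallTerm, qFalling_zero, qShift_zero]

lemma wallSum_symm (Q : ℝ) (K : ℕ) (x m n : ℤ) : wallSum Q K x m n = wallSum Q K x n m := by
  refine Finset.sum_congr rfl fun l _ => ?_
  simp only [wallTerm]
  ring

lemma wallSum_eq_of_lt (Q : ℝ) {K : ℕ} (x : ℤ) {m : ℕ} (n : ℤ) (h : m < K) :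
    wallSum Q K x m n = wallSum Q (m + 1) x m n := by
  refine (Finset.sum_subset (Finset.range_mono h) fun l _ hl => ?_).symm
  have : m < l := by simpa using hl
  simp [wallTerm, qFalling_eq_zero Q this]

lemma choose_two_succ (l : ℕ) : (l + 1).choose 2 = l + l.choose 2 := by
  simp [Nat.choose_succ_succ' l 1]

/-- Raising n changes one factor of the falling factorial, by Q^{n-l}(1 - Q^{l+1}); this cancels the
last factor of (Q;Q)_{l+1} and leaves a term of index l. -/
lemma wallTerm_succ_right (hQ0 : 0 < Q) (hQ1 : Q < 1) (x m n : ℤ) (l : ℕ) :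
    wallTerm Q x m (n + 1) (l + 1) =
      wallTerm Q x m n (l + 1) - Q ^ (n - x) * (1 - Q ^ m) * wallTerm Q x (m - 1) n l := by
  have h1 := (qShift_self_pos hQ0 hQ1 l).ne'
  have h2 := (one_sub_pow_pos hQ0 hQ1 l.succ_ne_zero).ne'
  have h3 : Q ^ (n - (l : ℤ)) = Q ^ n / Q ^ l := by rw [zpow_sub₀ hQ0.ne', zpow_natCast]
  have h4 : Q ^ (-(((l + 1 : ℕ) : ℤ) * x)) = Q ^ (-(l * x)) / Q ^ x := by
    rw [← zpow_sub₀ hQ0.ne']; congr 1; push_cast; ring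
  simp only [wallTerm]
  rw [qFalling_succ' Q l (n + 1), qFalling_succ Q l n, qFalling_succ' Q l m, add_sub_cancel_right,
    qShift_self_succ, h3, h4, choose_two_succ, pow_add Q l, zpow_sub₀ hQ0.ne', zpow_add_one₀ hQ0.ne']
  have := hQ0.ne'
  field_simp
  ring

/-- The same cancellation: raising x changes the power of Q by a multiple of 1 - Q^{l+1}. -/
lemma wallTerm_succ_left (hQ0 : 0 < Q) (hQ1 : Q < 1) (x m n : ℤ) (l : ℕ) :
    wallTerm Q (x + 1) m n (l + 1) = wallTerm Q x m n (l + 1) -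
      (1 - Q ^ m) * (1 - Q ^ n) * Q ^ (-x - 1) * wallTerm Q x (m - 1) (n - 1) l := by
  have h1 := (qShift_self_pos hQ0 hQ1 l).ne'
  have h2 := (one_sub_pow_pos hQ0 hQ1 l.succ_ne_zero).ne'
  have h4 : Q ^ (-(((l + 1 : ℕ) : ℤ) * x)) = Q ^ (-(l * x)) / Q ^ x := by
    rw [← zpow_sub₀ hQ0.ne']; congr 1; push_cast; ring
  have h5 : Q ^ (-(((l + 1 : ℕ) : ℤ) * (x + 1))) = Q ^ (-(l * x)) / Q ^ x / Q ^ l / Q := by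
    rw [← zpow_natCast Q l, ← zpow_sub₀ hQ0.ne', ← zpow_sub₀ hQ0.ne', div_eq_mul_inv _ Q,
      ← zpow_sub_one₀ hQ0.ne']
    congr 1; push_cast; ring
  have h6 : Q ^ (-x - 1) = 1 / Q ^ x / Q := by
    rw [zpow_sub_one₀ hQ0.ne', zpow_neg, one_div, div_eq_mul_inv]
  simp only [wallTerm]
  rw [qFalling_succ' Q l n, qFalling_succ' Q l m, qShift_self_succ, h4, h5, h6, choose_two_succ,
    pow_add Q l]
  have := hQ0.ne'
  field_simp
  ring

/-- A summation certificate. In the sum over l < K the boundary term at 0 vanishes through 1 - Q^0,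
the one at K through the falling factorial of m once m < K. -/
lemma wallTerm_telescope (hQ0 : 0 < Q) (hQ1 : Q < 1) (x m n : ℤ) (l : ℕ) :
    (Q ^ x - Q ^ n) * wallTerm Q x m n l - Q ^ m * (1 - Q ^ n) * wallTerm Q x m (n - 1) l +
        (1 - Q ^ x) * wallTerm Q (x - 1) m n l =
      Q ^ x * (1 - Q ^ l) * wallTerm Q x m n l -
        Q ^ x * (1 - Q ^ (l + 1)) * wallTerm Q x m n (l + 1) := by
  have h1 := (qShift_self_pos hQ0 hQ1 l).ne'
  have h2 : 1 - Q ^ l * Q ≠ 0 := by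
    rw [← pow_succ]; exact (one_sub_pow_pos hQ0 hQ1 l.succ_ne_zero).ne'
  have h3 (n : ℤ) : Q ^ (n - (l : ℤ)) = Q ^ n / Q ^ l := by rw [zpow_sub₀ hQ0.ne', zpow_natCast]
  have h4 : Q ^ (-(((l + 1 : ℕ) : ℤ) * x)) = Q ^ (-(l * x)) / Q ^ x := by
    rw [← zpow_sub₀ hQ0.ne']; congr 1; push_cast; ring
  have h5 : Q ^ (-(l * (x - 1))) = Q ^ (-(l * x)) * Q ^ l := by
    rw [← zpow_natCast Q l, ← zpow_add₀ hQ0.ne']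
    congr 1; ring
  have h6 : (1 - Q ^ n) * qFalling Q l (n - 1) = qFalling Q l n * (1 - Q ^ n / Q ^ l) := by
    rw [← qFalling_succ', qFalling_succ, h3]
  have h7 : Q ^ m * (1 - Q ^ n) * wallTerm Q x m (n - 1) l =
      Q ^ m * ((-1) ^ l * Q ^ l.choose 2 * Q ^ (-(l * x)) * qFalling Q l m *
        (qFalling Q l n * (1 - Q ^ n / Q ^ l)) / qShift Q Q l) := by
    rw [← h6]; simp only [wallTerm]; ring
  rw [h7]
  simp only [wallTerm]
  rw [qFalling_succ Q l n, qFalling_succ Q l m, qShift_self_succ, h4, h5, choose_two_succ,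
    h3, h3, pow_succ Q l, pow_add Q l (l.choose 2)]
  have := hQ0.ne'
  field_simp
  ring

lemma wallSum_succ_right (hQ0 : 0 < Q) (hQ1 : Q < 1) (K : ℕ) (x m n : ℤ) :
    wallSum Q (K + 1) x m (n + 1) =
      wallSum Q (K + 1) x m n - Q ^ (n - x) * (1 - Q ^ m) * wallSum Q K x (m - 1) n := by
  simp only [wallSum, Finset.sum_range_succ' _ K, wallTerm_succ_right hQ0 hQ1, wallTerm_zero,
    Finset.sum_sub_distrib, Finset.mul_sum]
  ring

lemma wallSum_succ_left (hQ0 : 0 < Q) (hQ1 : Q < 1) (K : ℕ) (x m n : ℤ) :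
    wallSum Q (K + 1) (x + 1) m n = wallSum Q (K + 1) x m n -
      (1 - Q ^ m) * (1 - Q ^ n) * Q ^ (-x - 1) * wallSum Q K x (m - 1) (n - 1) := by
  simp only [wallSum, Finset.sum_range_succ' _ K, wallTerm_succ_left hQ0 hQ1, wallTerm_zero,
    Finset.sum_sub_distrib, Finset.mul_sum]
  ring

lemma wallSum_lower (hQ0 : 0 < Q) (hQ1 : Q < 1) {K : ℕ} (x : ℤ) {m : ℕ} (n : ℤ) (h : m < K) :
    (Q ^ x - Q ^ n) * wallSum Q K x m n - Q ^ (m : ℤ) * (1 - Q ^ n) * wallSum Q K x m (n - 1) +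
      (1 - Q ^ x) * wallSum Q K (x - 1) m n = 0 := by
  simp only [wallSum, Finset.mul_sum, ← Finset.sum_sub_distrib, ← Finset.sum_add_distrib,
    wallTerm_telescope hQ0 hQ1]
  rw [Finset.sum_range_sub' (fun l => Q ^ x * (1 - Q ^ l) * wallTerm Q x m n l) K]
  simp [wallTerm, qFalling_eq_zero Q h]

/-- Eliminates the intermediate sums between `wallSum_succ_right`, applied in each of the two
symmetric arguments, and `wallSum_lower`. -/
lemma wallSum_succ_succ (hQ0 : 0 < Q) (hQ1 : Q < 1) {K : ℕ} (x : ℤ) {m n : ℕ} (hm : m < K)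
    (hn : n < K) :
    Q ^ x * wallSum Q (K + 1) x (m + 1) (n + 1) - Q ^ (m + n + 1 : ℤ) * wallSum Q K x m n =
      -((1 - Q ^ x) * wallSum Q K (x - 1) m n) := by
  have e : ∀ y : ℤ, wallSum Q (K + 1) y m n = wallSum Q K y m n := fun y => by
    rw [wallSum_eq_of_lt Q y n hm, wallSum_eq_of_lt Q y n (hm.trans K.lt_succ_self)]
  have e' : ∀ a : ℤ, wallSum Q (K + 1) x a n = wallSum Q K x a n := fun a => by
    rw [wallSum_symm, wallSum_eq_of_lt Q x a (hn.trans K.lt_succ_self), wallSum_symm Q K,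
      wallSum_eq_of_lt Q x a hn]
  have e'' : wallSum Q (K + 1) x m (n - 1) = wallSum Q K x m (n - 1) := by
    rw [wallSum_eq_of_lt Q x _ hm, wallSum_eq_of_lt Q x _ (hm.trans K.lt_succ_self)]
  have h1 := wallSum_succ_right hQ0 hQ1 K x (m + 1) n
  have h2 := wallSum_succ_right hQ0 hQ1 K x n m
  have h3 := wallSum_lower hQ0 hQ1 x n (hm.trans K.lt_succ_self)
  rw [wallSum_symm Q (K + 1) x n (m + 1), wallSum_symm Q (K + 1) x n m,
    wallSum_symm Q K x _ m] at h2
  rw [e, e, e''] at h3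
  rw [add_sub_cancel_right, h2, e] at h1
  rw [h1]
  have := hQ0.ne'
  rw [zpow_add_one₀ hQ0.ne', zpow_sub₀ hQ0.ne', zpow_sub₀ hQ0.ne', zpow_add_one₀ hQ0.ne',
    zpow_add₀ hQ0.ne']
  field_simp
  linear_combination h3

end WallSeries

/-! ### Normalization of the symmetric series and its match with the Wall polynomial. -/

section ClebschGordan

variable {q : ℝ}

lemma sq_pos_lt_one (hq0 : 0 < q) (hq1 : q < 1) : 0 < q ^ 2 ∧ q ^ 2 < 1 :=
  ⟨by positivity, pow_lt_one₀ hq0.le hq1 two_ne_zero⟩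

lemma sq_zpow_eq (q : ℝ) (n : ℤ) : (q ^ 2) ^ n = q ^ (2 * n) := by
  rw [zpow_mul]; norm_cast

/-- The matrix coefficient `√(1 - q^{2n})` of the annihilation operator. -/
noncomputable def ladder (q : ℝ) (n : ℤ) : ℝ := Real.sqrt (1 - (q ^ 2) ^ n)

/-- The normalization `(q²;q²)_n^{-1/2}`, extended by zero to negative `n`. -/
noncomputable def cgNorm (q : ℝ) (n : ℤ) : ℝ :=
  if 0 ≤ n then (Real.sqrt (qShift (q ^ 2) (q ^ 2) n.toNat))⁻¹ else 0

lemma ladder_sq (hq0 : 0 < q) (hq1 : q < 1) {n : ℤ} (hn : 0 ≤ n) :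
    ladder q n ^ 2 = 1 - (q ^ 2) ^ n := by
  obtain ⟨hQ0, hQ1⟩ := sq_pos_lt_one hq0 hq1
  lift n to ℕ using hn
  rw [ladder, Real.sq_sqrt]
  rw [zpow_natCast, sub_nonneg]
  exact pow_le_one₀ hQ0.le hQ1.le

lemma ladder_pos (hq0 : 0 < q) (hq1 : q < 1) {n : ℤ} (hn : 0 < n) : 0 < ladder q n := by
  obtain ⟨hQ0, hQ1⟩ := sq_pos_lt_one hq0 hq1
  lift n to ℕ using hn.le
  rw [ladder, Real.sqrt_pos, zpow_natCast]
  exact one_sub_pow_pos hQ0 hQ1 (by omega)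

lemma ladder_nonneg (q : ℝ) (n : ℤ) : 0 ≤ ladder q n := Real.sqrt_nonneg _

lemma ladder_zero (q : ℝ) : ladder q 0 = 0 := by simp [ladder]

lemma ladder_le_one (hq0 : 0 < q) (n : ℤ) : ladder q n ≤ 1 := by
  have : 0 < (q ^ 2) ^ n := by positivity
  exact Real.sqrt_le_iff.2 ⟨zero_le_one, by linarith⟩

/-- Holds for all integers: `ladder` vanishes at 0, and `cgNorm` on negative labels. This keeps the
later relations free of boundary cases. -/
lemma ladder_mul_cgNorm (hq0 : 0 < q) (hq1 : q < 1) (n : ℤ) :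
    ladder q n * cgNorm q n = cgNorm q (n - 1) := by
  obtain ⟨hQ0, hQ1⟩ := sq_pos_lt_one hq0 hq1
  rcases lt_trichotomy n 0 with hn | rfl | hn
  · simp [cgNorm, not_le.2 hn, show ¬ (1 ≤ n) by omega]
  · simp [cgNorm, ladder_zero]
  · obtain ⟨k, rfl⟩ : ∃ k : ℕ, n = k + 1 := ⟨(n - 1).toNat, by omega⟩
    have h := one_sub_pow_pos hQ0 hQ1 k.succ_ne_zero
    rw [cgNorm, cgNorm, if_pos hn.le, if_pos (by omega), show (k + 1 : ℤ).toNat = k + 1 by omega,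
      show (k + 1 - 1 : ℤ).toNat = k by omega, qShift_self_succ,
      Real.sqrt_mul (qShift_self_pos hQ0 hQ1 k).le, ladder]
    rw [show (q ^ 2) ^ ((k : ℤ) + 1) = (q ^ 2) ^ (k + 1) by norm_cast]
    have h2 := (Real.sqrt_pos.2 h).ne'
    rw [mul_inv]
    field_simp

lemma ladder_mul_cgNorm_pred (hq0 : 0 < q) (hq1 : q < 1) (n : ℤ) :
    ladder q n * cgNorm q (n - 1) = (1 - (q ^ 2) ^ n) * cgNorm q n := by
  rw [← ladder_mul_cgNorm hq0 hq1, ← mul_assoc, ← sq]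
  by_cases hn : 0 ≤ n
  · rw [ladder_sq hq0 hq1 hn]
  · simp [cgNorm, hn]

/-- The Clebsch-Gordan coefficient without its normalization. -/
noncomputable def cgCore (q : ℝ) (K : ℕ) (x m n : ℤ) : ℝ :=
  (-1) ^ x * q ^ (x * (m + n + 1) - m * n) * wallSum (q ^ 2) K x m n

lemma cgCore_symm (q : ℝ) (K : ℕ) (x m n : ℤ) : cgCore q K x m n = cgCore q K x n m := by
  rw [cgCore, cgCore, wallSum_symm, add_comm m n, mul_comm m n]

lemma cgCore_succ_right (hq0 : 0 < q) (hq1 : q < 1) (K : ℕ) (x m n : ℤ) :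
    q ^ m * cgCore q (K + 1) x m (n + 1) + q ^ n * (1 - (q ^ 2) ^ m) * cgCore q K x (m - 1) n =
      q ^ x * cgCore q (K + 1) x m n := by
  obtain ⟨hQ0, hQ1⟩ := sq_pos_lt_one hq0 hq1
  have h1 : q ^ m * q ^ (x * (m + (n + 1) + 1) - m * (n + 1)) =
      q ^ x * q ^ (x * (m + n + 1) - m * n) := by
    simp only [← zpow_add₀ hq0.ne']; congr 1; ring
  have h2 : q ^ m * q ^ (x * (m + (n + 1) + 1) - m * (n + 1)) * (q ^ 2) ^ (n - x) =
      q ^ n * q ^ (x * (m - 1 + n + 1) - (m - 1) * n) := by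
    simp only [sq_zpow_eq, ← zpow_add₀ hq0.ne']; congr 1; ring
  simp only [cgCore]
  rw [wallSum_succ_right hQ0 hQ1]
  linear_combination (-1) ^ x * wallSum (q ^ 2) (K + 1) x m n * h1 -
    (-1) ^ x * (1 - (q ^ 2) ^ m) * wallSum (q ^ 2) K x (m - 1) n * h2

lemma cgCore_raise (hq0 : 0 < q) (hq1 : q < 1) (K : ℕ) (x m n : ℤ) :
    (1 - (q ^ 2) ^ m) * (1 - (q ^ 2) ^ n) * cgCore q K x (m - 1) (n - 1) -
      q ^ (m + n + 1) * cgCore q (K + 1) x m n = cgCore q (K + 1) (x + 1) m n := by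
  obtain ⟨hQ0, hQ1⟩ := sq_pos_lt_one hq0 hq1
  have h1 : q ^ ((x + 1) * (m + n + 1) - m * n) =
      q ^ (m + n + 1) * q ^ (x * (m + n + 1) - m * n) := by
    simp only [← zpow_add₀ hq0.ne']; congr 1; ring
  have h2 : q ^ ((x + 1) * (m + n + 1) - m * n) * (q ^ 2) ^ (-x - 1) =
      q ^ (x * (m - 1 + (n - 1) + 1) - (m - 1) * (n - 1)) := by
    simp only [sq_zpow_eq, ← zpow_add₀ hq0.ne']; congr 1; ring
  simp only [cgCore]
  rw [wallSum_succ_left hQ0 hQ1, zpow_add_one₀ (by norm_num : (-1 : ℝ) ≠ 0)]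
  linear_combination (-1) ^ x * wallSum (q ^ 2) (K + 1) x m n * h1 -
    (-1) ^ x * (1 - (q ^ 2) ^ m) * (1 - (q ^ 2) ^ n) *
      wallSum (q ^ 2) K x (m - 1) (n - 1) * h2

lemma cgCore_lower (hq0 : 0 < q) (hq1 : q < 1) {K : ℕ} (x : ℤ) {m n : ℕ} (hm : m < K)
    (hn : n < K) :
    cgCore q (K + 1) x (m + 1) (n + 1) - q ^ (m + n + 1 : ℤ) * cgCore q K x m n =
      (1 - (q ^ 2) ^ x) * cgCore q K (x - 1) m n := by
  obtain ⟨hQ0, hQ1⟩ := sq_pos_lt_one hq0 hq1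
  have h1 : q ^ (x * ((m : ℤ) + 1 + (n + 1) + 1) - (m + 1) * (n + 1)) =
      q ^ ((x - 1) * (m + n + 1 : ℤ) - m * n) * (q ^ 2) ^ x := by
    simp only [sq_zpow_eq, ← zpow_add₀ hq0.ne']; congr 1; ring
  have h2 : q ^ (m + n + 1 : ℤ) * q ^ (x * (m + n + 1 : ℤ) - m * n) =
      q ^ ((x - 1) * (m + n + 1 : ℤ) - m * n) * (q ^ 2) ^ (m + n + 1 : ℤ) := by
    simp only [sq_zpow_eq, ← zpow_add₀ hq0.ne']; congr 1; ring
  have h3 := wallSum_succ_succ hQ0 hQ1 x hm hn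
  simp only [cgCore]
  rw [zpow_sub_one₀ (by norm_num : (-1 : ℝ) ≠ 0), h1]
  linear_combination (-1) ^ x * q ^ ((x - 1) * (m + n + 1 : ℤ) - m * n) * h3 -
    (-1) ^ x * wallSum (q ^ 2) K x m n * h2

lemma qShift_inv_pow {Q : ℝ} (hQ0 : 0 < Q) (i l : ℕ) :
    qShift (Q ^ (i + l))⁻¹ Q i * (Q ^ (i * l) * Q ^ (i + 1).choose 2) * qShift Q Q l =
      (-1) ^ i * qShift Q Q (i + l) := by
  induction i with
  | zero => simp [qShift_zero]
  | succ i ih =>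
    have h1 : qShift (Q ^ (i + 1 + l))⁻¹ Q (i + 1) =
        (1 - (Q ^ (i + 1 + l))⁻¹) * qShift (Q ^ (i + l))⁻¹ Q i := by
      rw [add_comm i 1, qShift_add, add_comm 1 i]
      simp only [qShift, Finset.prod_range_one, pow_zero, mul_one, pow_one]
      congr 1
      refine Finset.prod_congr rfl fun j _ => ?_
      congr 2
      rw [show i + 1 + l = i + l + 1 by ring, pow_succ]
      field_simp
    have h2 : qShift Q Q (i + 1 + l) = qShift Q Q (i + l) * (1 - Q ^ (i + 1 + l)) := by
      rw [show i + 1 + l = i + l + 1 by ring, qShift_self_succ]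
    have h3 : (1 - (Q ^ (i + 1 + l))⁻¹) * Q ^ (i + 1 + l) = -(1 - Q ^ (i + 1 + l)) := by
      have : Q ^ (i + 1 + l) ≠ 0 := by positivity
      field_simp
      ring
    rw [h1, h2, choose_two_succ (i + 1), pow_add Q (i + 1) ((i + 1).choose 2),
      show (i + 1) * l = i * l + l by ring, pow_add Q (i * l) l]
    rw [pow_add Q (i + 1) l] at h3 ⊢
    linear_combination qShift (Q ^ (i + l))⁻¹ Q i * (Q ^ (i * l) * Q ^ (i + 1).choose 2) *
      qShift Q Q l * h3 - (1 - Q ^ (i + 1) * Q ^ l) * ih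

lemma two_mul_choose_two (l : ℕ) : (2 : ℤ) * (l.choose 2 : ℕ) = l * (l - 1) := by
  induction l with
  | zero => simp
  | succ l ih => rw [choose_two_succ]; push_cast; linear_combination ih

/-- With n = i + l, term l of the symmetric series is term i = n - l of the ₂φ₁: the two are the
same terminating sum in opposite orders. -/
lemma wallTerm_eq_phi21_term (hq0 : 0 < q) (hq1 : q < 1) (x p i l : ℕ) :
    q ^ ((x : ℤ) * (((i + l + p : ℕ) : ℤ) + (i + l : ℕ) + 1) - (i + l + p : ℕ) * (i + l : ℕ)) *
        wallTerm (q ^ 2) x (i + l + p : ℕ) (i + l : ℕ) l =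
      (-1) ^ (i + l) * q ^ (((p : ℤ) + 1) * (x - (i + l : ℕ))) *
        (qShift (q ^ 2) (q ^ 2) (i + l + p) / qShift (q ^ 2) (q ^ 2) p) *
        (qShift ((q ^ 2) ^ (i + l))⁻¹ (q ^ 2) i * qShift 0 (q ^ 2) i /
          (qShift ((q ^ 2) ^ p * q ^ 2) (q ^ 2) i * qShift (q ^ 2) (q ^ 2) i) *
          (q ^ 2 * (q ^ 2) ^ x) ^ i) := by
  obtain ⟨hQ0, hQ1⟩ := sq_pos_lt_one hq0 hq1
  have e1 := qFalling_mul_qShift (q ^ 2) l i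
  have e2 := qFalling_mul_qShift (q ^ 2) l (p + i)
  rw [show p + i + l = i + l + p by ring] at e2
  have e3 := qShift_inv_pow hQ0 i l
  have e4 : qShift (q ^ 2) (q ^ 2) p * qShift ((q ^ 2) ^ p * q ^ 2) (q ^ 2) i =
      qShift (q ^ 2) (q ^ 2) (p + i) := by
    rw [qShift_add]; ring_nf
  have e5 : q ^ (((p : ℤ) + 1) * (x - (i + l : ℕ))) * (q ^ 2 * (q ^ 2) ^ x) ^ i =
      q ^ ((x : ℤ) * (((i + l + p : ℕ) : ℤ) + (i + l : ℕ) + 1) - (i + l + p : ℕ) * (i + l : ℕ)) *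
      ((q ^ 2) ^ l.choose 2 * (q ^ 2) ^ (-((l : ℤ) * x))) *
        ((q ^ 2) ^ (i * l) * (q ^ 2) ^ (i + 1).choose 2) := by
    have c1 := two_mul_choose_two l
    have c2 := two_mul_choose_two (i + 1)
    simp only [← zpow_natCast, ← zpow_add₀ hq0.ne', ← zpow_mul]
    congr 1
    push_cast at c1 c2 ⊢
    linear_combination -c1 - c2
  have p1 := (qShift_self_pos hQ0 hQ1 l).ne'
  have p2 := (qShift_self_pos hQ0 hQ1 p).ne'
  have p3 := (qShift_self_pos hQ0 hQ1 i).ne'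
  have p4 : qShift ((q ^ 2) ^ p * q ^ 2) (q ^ 2) i ≠ 0 := by
    rw [← pow_succ]; exact (qShift_pow_pos hQ0 hQ1 p i).ne'
  have p6 : ((q ^ 2) ^ (i * l) * (q ^ 2) ^ (i + 1).choose 2) ≠ 0 := by positivity
  have p7 := (qShift_self_pos hQ0 hQ1 (p + i)).ne'
  have s1 : qFalling (q ^ 2) l (i + l : ℕ) =
      qShift (q ^ 2) (q ^ 2) (i + l) / qShift (q ^ 2) (q ^ 2) i := by rw [← e1]; field_simp
  have s2 : qFalling (q ^ 2) l (i + l + p : ℕ) = qShift (q ^ 2) (q ^ 2) (i + l + p) /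
      (qShift (q ^ 2) (q ^ 2) p * qShift ((q ^ 2) ^ p * q ^ 2) (q ^ 2) i) := by
    rw [e4, ← e2]; field_simp
  have s3 : qShift ((q ^ 2) ^ (i + l))⁻¹ (q ^ 2) i = (-1) ^ i * qShift (q ^ 2) (q ^ 2) (i + l) /
      (((q ^ 2) ^ (i * l) * (q ^ 2) ^ (i + 1).choose 2) * qShift (q ^ 2) (q ^ 2) l) := by
    rw [← e3]; field_simp
  have hs : ((-1 : ℝ)) ^ (i + l) * (-1) ^ i = (-1) ^ l := by
    rw [pow_add, mul_right_comm, ← mul_pow]; simp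
  rw [wallTerm, s1, s2, s3, qShift_zero_left]
  generalize (q ^ 2) ^ (i * l) * (q ^ 2) ^ (i + 1).choose 2 = A at *
  generalize qShift ((q ^ 2) ^ p * q ^ 2) (q ^ 2) i = B at *
  generalize qShift (q ^ 2) (q ^ 2) l = D at *
  generalize qShift (q ^ 2) (q ^ 2) i = E at *
  generalize qShift (q ^ 2) (q ^ 2) p = F at *
  generalize qShift (q ^ 2) (q ^ 2) (i + l) = G at *
  generalize qShift (q ^ 2) (q ^ 2) (i + l + p) = H at *
  calc _ = (q ^ ((x : ℤ) * (((i + l + p : ℕ) : ℤ) + (i + l : ℕ) + 1) -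
          (i + l + p : ℕ) * (i + l : ℕ)) * ((q ^ 2) ^ l.choose 2 * (q ^ 2) ^ (-((l : ℤ) * x))) *
          A) * (-1) ^ l * (H * G / (F * B * E * D * A)) := by field_simp
    _ = (q ^ (((p : ℤ) + 1) * (x - (i + l : ℕ))) * (q ^ 2 * (q ^ 2) ^ x) ^ i) *
          ((-1) ^ (i + l) * (-1) ^ i) * (H * G / (F * B * E * D * A)) := by rw [← e5, hs]
    _ = _ := by ring

end ClebschGordan

/-! ### The four intertwining relations of the Clebsch-Gordan coefficients. -/

section ClebschGordanRelations

variable {q : ℝ}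

lemma phi21_terminating {Q : ℝ} (hQ0 : 0 < Q) (n : ℕ) (b c z : ℝ) :
    phi21 (Q ^ n)⁻¹ b c Q z = ∑ i ∈ Finset.range (n + 1),
      qShift (Q ^ n)⁻¹ Q i * qShift b Q i / (qShift c Q i * qShift Q Q i) * z ^ i := by
  refine tsum_eq_sum fun i hi => ?_
  have hi : n < i := by simpa using hi
  have h : qShift (Q ^ n)⁻¹ Q i = 0 := by
    refine Finset.prod_eq_zero (Finset.mem_range.2 hi) ?_
    have : Q ^ n ≠ 0 := by positivity
    field_simp
    ring
  simp [h]

lemma wallBar_eq (hq0 : 0 < q) (hq1 : q < 1) (n x p : ℕ) :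
    wallBar n x ((q ^ 2) ^ p) (q ^ 2) =
      Real.sqrt (qShiftInf (q ^ 2) (q ^ 2)) *
        ((Real.sqrt (qShift (q ^ 2) (q ^ 2) x))⁻¹ *
          (Real.sqrt (qShift (q ^ 2) (q ^ 2) (n + p)))⁻¹ *
          (Real.sqrt (qShift (q ^ 2) (q ^ 2) n))⁻¹) *
        ((-1) ^ x * q ^ ((x : ℤ) * (((n + p : ℕ) : ℤ) + n + 1) - (n + p : ℕ) * n) *
          wallSum (q ^ 2) (n + 1) x (n + p : ℕ) n) := by
  obtain ⟨hQ0, hQ1⟩ := sq_pos_lt_one hq0 hq1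
  have px := qShift_self_pos hQ0 hQ1 x
  have pn := qShift_self_pos hQ0 hQ1 n
  have pp := qShift_self_pos hQ0 hQ1 p
  have pnp := qShift_self_pos hQ0 hQ1 (n + p)
  have pinf := qShiftInf_self_pos hQ0 hQ1
  have e1 : qShiftInf ((q ^ 2) ^ p * q ^ 2) (q ^ 2) =
      qShiftInf (q ^ 2) (q ^ 2) / qShift (q ^ 2) (q ^ 2) p := by
    rw [← pow_succ, qShiftInf_self_eq hQ0 hQ1 p, mul_div_cancel_left₀ _ pp.ne']
  have e2 : qShift ((q ^ 2) ^ p * q ^ 2) (q ^ 2) n =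
      qShift (q ^ 2) (q ^ 2) (n + p) / qShift (q ^ 2) (q ^ 2) p := by
    rw [add_comm n p, qShift_add, mul_comm (q ^ 2)]; field_simp
  have e3 : ((q ^ 2) ^ p * q ^ 2) ^ ((x : ℤ) - n) = (q ^ (((p : ℤ) + 1) * (x - n))) ^ 2 := by
    rw [← pow_succ, ← zpow_natCast, sq_zpow_eq, ← zpow_mul, ← zpow_natCast, ← zpow_mul]
    congr 1; push_cast; ring
  have e4 : Real.sqrt (((q ^ 2) ^ p * q ^ 2) ^ ((x : ℤ) - n) *
      qShiftInf ((q ^ 2) ^ p * q ^ 2) (q ^ 2) * qShift ((q ^ 2) ^ p * q ^ 2) (q ^ 2) n /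
        (qShift (q ^ 2) (q ^ 2) n * qShift (q ^ 2) (q ^ 2) x)) =
      q ^ (((p : ℤ) + 1) * (x - n)) * (Real.sqrt (qShiftInf (q ^ 2) (q ^ 2)) *
        Real.sqrt (qShift (q ^ 2) (q ^ 2) (n + p)) * (Real.sqrt (qShift (q ^ 2) (q ^ 2) n))⁻¹ *
        (Real.sqrt (qShift (q ^ 2) (q ^ 2) x))⁻¹ / qShift (q ^ 2) (q ^ 2) p) := by
    refine (Real.sqrt_eq_iff_mul_self_eq (by rw [e1, e2]; positivity) (by positivity)).2 ?_
    rw [e1, e2, e3, ← sq]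
    simp only [div_pow, mul_pow, inv_pow, Real.sq_sqrt px.le, Real.sq_sqrt pn.le,
      Real.sq_sqrt pnp.le, Real.sq_sqrt pinf.le]
    field_simp
  rw [wallBar, wallPoly, phi21_terminating hQ0, e4]
  have e5 : q ^ ((x : ℤ) * (((n + p : ℕ) : ℤ) + n + 1) - (n + p : ℕ) * n) *
      wallSum (q ^ 2) (n + 1) x (n + p : ℕ) n =
      ∑ i ∈ Finset.range (n + 1), (-1) ^ n * q ^ (((p : ℤ) + 1) * (x - n)) *
        (qShift (q ^ 2) (q ^ 2) (n + p) / qShift (q ^ 2) (q ^ 2) p) *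
        (qShift ((q ^ 2) ^ n)⁻¹ (q ^ 2) i * qShift 0 (q ^ 2) i /
          (qShift ((q ^ 2) ^ p * q ^ 2) (q ^ 2) i * qShift (q ^ 2) (q ^ 2) i) *
          (q ^ 2 * (q ^ 2) ^ x) ^ i) := by
    rw [wallSum, ← Finset.sum_range_reflect, Finset.mul_sum]
    refine Finset.sum_congr rfl fun i hi => ?_
    obtain ⟨l, rfl⟩ : ∃ l, n = i + l := ⟨n - i, by have := Finset.mem_range.1 hi; omega⟩
    rw [show i + l + 1 - 1 - i = l by omega]
    exact wallTerm_eq_phi21_term hq0 hq1 x p i l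
  rw [mul_assoc ((-1 : ℝ) ^ x), e5, ← Finset.mul_sum, pow_add]
  have h1 : Real.sqrt (qShift (q ^ 2) (q ^ 2) (n + p)) =
      (Real.sqrt (qShift (q ^ 2) (q ^ 2) (n + p)))⁻¹ * qShift (q ^ 2) (q ^ 2) (n + p) := by
    have := Real.mul_self_sqrt pnp.le
    have := (Real.sqrt_pos.2 pnp).ne'
    field_simp
    linarith
  generalize (∑ i ∈ Finset.range (n + 1),
    qShift ((q ^ 2) ^ n)⁻¹ (q ^ 2) i * qShift 0 (q ^ 2) i /
      (qShift ((q ^ 2) ^ p * q ^ 2) (q ^ 2) i * qShift (q ^ 2) (q ^ 2) i) *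
      (q ^ 2 * (q ^ 2) ^ x) ^ i) = S
  linear_combination (-1) ^ n * (-1) ^ x * q ^ (((p : ℤ) + 1) * (x - n)) *
    Real.sqrt (qShiftInf (q ^ 2) (q ^ 2)) * (Real.sqrt (qShift (q ^ 2) (q ^ 2) n))⁻¹ *
    (Real.sqrt (qShift (q ^ 2) (q ^ 2) x))⁻¹ / qShift (q ^ 2) (q ^ 2) p * S * h1

lemma clebschGordan_symm (q : ℝ) (x m n : ℤ) : clebschGordan q x m n = clebschGordan q x n m := by
  rw [clebschGordan, clebschGordan, min_comm, show (m - n).natAbs = (n - m).natAbs by omega]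
  simp only [and_comm (a := 0 ≤ m)]

lemma clebschGordan_eq_zero {q : ℝ} {x m n : ℤ} (h : ¬ (0 ≤ x ∧ 0 ≤ m ∧ 0 ≤ n)) :
    clebschGordan q x m n = 0 := if_neg h

lemma clebschGordan_eq_of_le (hq0 : 0 < q) (hq1 : q < 1) (x : ℤ) {m n : ℤ} (h : n ≤ m) {K : ℕ}
    (hn : n < K) :
    clebschGordan q x m n = Real.sqrt (qShiftInf (q ^ 2) (q ^ 2)) *
      (cgNorm q x * cgNorm q m * cgNorm q n) * cgCore q K x m n := by
  by_cases h0 : 0 ≤ x ∧ 0 ≤ m ∧ 0 ≤ n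
  · rw [clebschGordan, if_pos h0]
    obtain ⟨hx, hm, hn0⟩ := h0
    lift x to ℕ using hx
    lift n to ℕ using hn0
    lift m to ℕ using hm
    obtain ⟨p, rfl⟩ : ∃ p, m = n + p := ⟨m - n, by omega⟩
    rw [min_eq_right h, show (((n + p : ℕ) : ℤ) - n).natAbs = p by omega, Int.toNat_natCast,
      Int.toNat_natCast, wallBar_eq hq0 hq1]
    simp only [cgNorm, Int.natCast_nonneg, if_true, Int.toNat_natCast, cgCore, zpow_natCast]
    rw [wallSum_symm _ K, wallSum_eq_of_lt _ _ _ (by omega : n < K), wallSum_symm]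
  · rw [clebschGordan_eq_zero h0]
    by_cases hx : 0 ≤ x
    · by_cases hm : 0 ≤ m
      · have : ¬ 0 ≤ n := fun h => h0 ⟨hx, hm, h⟩
        simp [cgNorm, this]
      · simp [cgNorm, hm]
    · simp [cgNorm, hx]

/-- The truncation K is free beyond min(m,n), so all coefficients in a relation can share K or K +
1; negative labels are handled by `cgNorm`. -/
theorem clebschGordan_eq (hq0 : 0 < q) (hq1 : q < 1) (x : ℤ) {m n : ℤ} {K : ℕ}
    (h : min m n < K) :
    clebschGordan q x m n = Real.sqrt (qShiftInf (q ^ 2) (q ^ 2)) *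
      (cgNorm q x * cgNorm q m * cgNorm q n) * cgCore q K x m n := by
  rcases le_total n m with hnm | hnm
  · exact clebschGordan_eq_of_le hq0 hq1 x hnm (by simpa [hnm] using h)
  · rw [clebschGordan_symm, clebschGordan_eq_of_le hq0 hq1 x hnm (K := K) (by simpa [hnm] using h),
      cgCore_symm]
    ring

/-- The relation coming from the coproduct of `γ`. -/
theorem clebschGordan_gamma (hq0 : 0 < q) (hq1 : q < 1) (x m n : ℤ) :
    q ^ m * ladder q (n + 1) * clebschGordan q x m (n + 1) +
      q ^ n * ladder q m * clebschGordan q x (m - 1) n = q ^ x * clebschGordan q x m n := by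
  obtain ⟨K, hK⟩ : ∃ K : ℕ, m < K ∧ n < K := ⟨max m.toNat n.toNat + 1, by omega⟩
  rw [clebschGordan_eq hq0 hq1 x (K := K + 1) (m := m) (n := n + 1) (by push_cast; omega),
    clebschGordan_eq hq0 hq1 x (K := K) (m := m - 1) (n := n) (by omega),
    clebschGordan_eq hq0 hq1 x (K := K + 1) (m := m) (n := n) (by push_cast; omega)]
  have h1 := ladder_mul_cgNorm hq0 hq1 (n + 1)
  have h2 := ladder_mul_cgNorm_pred hq0 hq1 m
  rw [add_sub_cancel_right] at h1
  linear_combination Real.sqrt (qShiftInf (q ^ 2) (q ^ 2)) * cgNorm q x *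
    (cgNorm q m * q ^ m * cgCore q (K + 1) x m (n + 1) * h1 +
      cgNorm q n * q ^ n * cgCore q K x (m - 1) n * h2 +
      cgNorm q m * cgNorm q n * cgCore_succ_right hq0 hq1 K x m n)

/-- The relation coming from the coproduct of `γ*`. -/
theorem clebschGordan_gamma' (hq0 : 0 < q) (hq1 : q < 1) (x m n : ℤ) :
    q ^ n * ladder q (m + 1) * clebschGordan q x (m + 1) n +
      q ^ m * ladder q n * clebschGordan q x m (n - 1) = q ^ x * clebschGordan q x m n := by
  rw [clebschGordan_symm q x (m + 1), clebschGordan_symm q x m (n - 1), clebschGordan_symm q x m n]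
  exact clebschGordan_gamma hq0 hq1 x n m

/-- The relation coming from the coproduct of `α*`. -/
theorem clebschGordan_raise (hq0 : 0 < q) (hq1 : q < 1) (x m n : ℤ) :
    ladder q m * ladder q n * clebschGordan q x (m - 1) (n - 1) -
      q ^ (m + n + 1) * clebschGordan q x m n = ladder q (x + 1) * clebschGordan q (x + 1) m n := by
  obtain ⟨K, hK⟩ : ∃ K : ℕ, m < K ∧ n < K := ⟨max m.toNat n.toNat + 1, by omega⟩
  rw [clebschGordan_eq hq0 hq1 x (K := K) (m := m - 1) (n := n - 1) (by omega),
    clebschGordan_eq hq0 hq1 x (K := K + 1) (m := m) (n := n) (by push_cast; omega),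
    clebschGordan_eq hq0 hq1 (x + 1) (K := K + 1) (m := m) (n := n) (by push_cast; omega)]
  have h1 := ladder_mul_cgNorm hq0 hq1 (x + 1)
  have h2 := ladder_mul_cgNorm_pred hq0 hq1 m
  have h3 := ladder_mul_cgNorm_pred hq0 hq1 n
  rw [add_sub_cancel_right] at h1
  linear_combination Real.sqrt (qShiftInf (q ^ 2) (q ^ 2)) *
    (cgNorm q x * cgCore q K x (m - 1) (n - 1) * (ladder q n * cgNorm q (n - 1) * h2 +
      (1 - (q ^ 2) ^ m) * cgNorm q m * h3) -
      cgNorm q m * cgNorm q n * cgCore q (K + 1) (x + 1) m n * h1 +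
      cgNorm q x * cgNorm q m * cgNorm q n * cgCore_raise hq0 hq1 K x m n)

/-- The relation coming from the coproduct of `α`. -/
theorem clebschGordan_lower (hq0 : 0 < q) (hq1 : q < 1) (x m n : ℤ) :
    ladder q (m + 1) * ladder q (n + 1) * clebschGordan q x (m + 1) (n + 1) -
      q ^ (m + n + 1) * clebschGordan q x m n = ladder q x * clebschGordan q (x - 1) m n := by
  obtain ⟨K, hK⟩ : ∃ K : ℕ, m < K ∧ n < K := ⟨max m.toNat n.toNat + 1, by omega⟩
  rw [clebschGordan_eq hq0 hq1 x (K := K + 1) (m := m + 1) (n := n + 1) (by push_cast; omega),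
    clebschGordan_eq hq0 hq1 x (K := K) (m := m) (n := n) (by omega),
    clebschGordan_eq hq0 hq1 (x - 1) (K := K) (m := m) (n := n) (by omega)]
  have h1 := ladder_mul_cgNorm_pred hq0 hq1 x
  have h2 := ladder_mul_cgNorm hq0 hq1 (m + 1)
  have h3 := ladder_mul_cgNorm hq0 hq1 (n + 1)
  rw [add_sub_cancel_right] at h2 h3
  -- `cgCore_lower` needs m, n ≥ 0, because its telescoping sum must terminate; otherwise the
  -- norming factors vanish.
  have h4 : cgNorm q m * cgNorm q n * (cgCore q (K + 1) x (m + 1) (n + 1) -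
      q ^ (m + n + 1) * cgCore q K x m n - (1 - (q ^ 2) ^ x) * cgCore q K (x - 1) m n) = 0 := by
    by_cases hm : 0 ≤ m
    · by_cases hn : 0 ≤ n
      · lift m to ℕ using hm
        lift n to ℕ using hn
        rw [cgCore_lower hq0 hq1 x (by omega) (by omega), sub_self, mul_zero]
      · simp [cgNorm, hn]
    · simp [cgNorm, hm]
  linear_combination Real.sqrt (qShiftInf (q ^ 2) (q ^ 2)) *
    (cgNorm q x * cgCore q (K + 1) x (m + 1) (n + 1) *
      (ladder q (n + 1) * cgNorm q (n + 1) * h2 + cgNorm q m * h3) -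
      cgNorm q m * cgNorm q n * cgCore q K (x - 1) m n * h1 + cgNorm q x * h4)

/-- The relation expressing `α* ⊗ 1` through coproducts. -/
theorem clebschGordan_raise_left (hq0 : 0 < q) (hq1 : q < 1) (x z b : ℤ) :
    ladder q z * clebschGordan q x z b = q ^ (b + x) * clebschGordan q x (z - 1) b +
      ladder q b * ladder q x * clebschGordan q (x - 1) (z - 1) (b - 1) := by
  by_cases hb : 0 ≤ b
  · have h1 := clebschGordan_gamma' hq0 hq1 x (z - 1) b
    have h2 := clebschGordan_lower hq0 hq1 x (z - 1) (b - 1)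
    have h3 := ladder_sq hq0 hq1 hb
    rw [sub_add_cancel] at h1 h2
    rw [sub_add_cancel, show z - 1 + (b - 1) + 1 = (z - 1) + b by ring,
      zpow_add₀ hq0.ne'] at h2
    rw [sq_zpow_eq, two_mul, zpow_add₀ hq0.ne'] at h3
    rw [zpow_add₀ hq0.ne']
    -- The terms in C_{x,z-1,b-1} cancel, and the weights of C_{x,z,b} add up to q^{2b} + (1 -
    -- q^{2b}) = 1.
    linear_combination q ^ b * h1 + ladder q b * h2 - ladder q z * clebschGordan q x z b * h3
  · rw [clebschGordan_eq_zero (fun h => hb h.2.2), clebschGordan_eq_zero (fun h => hb h.2.2),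
      clebschGordan_eq_zero (fun h => hb (by omega))]
    simp

theorem clebschGordan_zero_left (hq0 : 0 < q) (hq1 : q < 1) {m n : ℤ} (hm : 0 ≤ m) (hn : 0 ≤ n) :
    clebschGordan q 0 m n = Real.sqrt (qShiftInf (q ^ 2) (q ^ 2)) *
      (cgNorm q m * cgNorm q n) * q ^ (m * n) := by
  lift n to ℕ using hn
  induction n generalizing m with
  | zero =>
    rw [clebschGordan_eq hq0 hq1 0 (K := 1) (by push_cast; omega)]
    simp [cgCore, wallSum, wallTerm_zero, cgNorm, qShift_zero]
  | succ n ih =>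
    rcases hm.eq_or_lt with rfl | hm
    · rw [clebschGordan_eq hq0 hq1 0 (K := 1) (by push_cast; omega)]
      simp [cgCore, wallSum, wallTerm_zero, cgNorm, qShift_zero]
    -- At x = 0 the right-hand side carries `ladder q 0 = 0`, so a two-term recursion along the
    -- diagonal remains.
    · have h1 := clebschGordan_lower hq0 hq1 0 (m - 1) n
      rw [ladder_zero, zero_mul, ih (by omega), sub_add_cancel] at h1
      have h2 := ladder_mul_cgNorm hq0 hq1 m
      have h3 := ladder_mul_cgNorm hq0 hq1 (n + 1)
      rw [add_sub_cancel_right] at h3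
      have p1 := (ladder_pos hq0 hq1 hm).ne'
      have p2 := (ladder_pos hq0 hq1 (show (0 : ℤ) < n + 1 by omega)).ne'
      have h4 : q ^ (m - 1 + n + 1) * q ^ ((m - 1) * n) = q ^ (m * (n + 1)) := by
        rw [← zpow_add₀ hq0.ne']; congr 1; ring
      push_cast
      refine mul_left_cancel₀ (mul_ne_zero p1 p2) ?_
      rw [← h2, ← h3] at h1
      rw [← h4]
      linear_combination h1

/-- At the bottom, `C_{0,m,n}` satisfies a two-term relation. -/
theorem ladder_mul_clebschGordan_zero (hq0 : 0 < q) (hq1 : q < 1) (m n : ℤ) :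
    ladder q m * clebschGordan q 0 m n = q ^ n * clebschGordan q 0 (m - 1) n := by
  have h := clebschGordan_raise_left hq0 hq1 0 m n
  rw [h, ladder_zero]
  simp

theorem clebschGordan_right_zero (hq0 : 0 < q) (hq1 : q < 1) (x m : ℤ) :
    clebschGordan q x m 0 = Real.sqrt (qShiftInf (q ^ 2) (q ^ 2)) *
      (cgNorm q x * cgNorm q m) * ((-1) ^ x * q ^ (x * (m + 1))) := by
  rw [clebschGordan_eq hq0 hq1 x (K := 1) (by push_cast; omega)]
  simp [cgCore, wallSum, wallTerm_zero, cgNorm, qShift_zero]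

end ClebschGordanRelations

/-! ### Summability and orthonormality of the Clebsch-Gordan coefficients. -/

section ClebschGordanOrthonormal

variable {q : ℝ}

lemma summable_pow_natAbs (hq0 : 0 < q) (hq1 : q < 1) : Summable fun m : ℤ => q ^ m.natAbs := by
  refine Summable.of_nat_of_neg ?_ ?_ <;>
    simpa using summable_geometric_of_lt_one hq0.le hq1

lemma cgNorm_nonneg (q : ℝ) (n : ℤ) : 0 ≤ cgNorm q n := by
  unfold cgNorm; split_ifs <;> positivity

lemma cgNorm_le (hq0 : 0 < q) (hq1 : q < 1) (n : ℤ) :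
    cgNorm q n ≤ (Real.sqrt (qShiftInf (q ^ 2) (q ^ 2)))⁻¹ := by
  obtain ⟨hQ0, hQ1⟩ := sq_pos_lt_one hq0 hq1
  unfold cgNorm
  split_ifs
  · exact inv_anti₀ (Real.sqrt_pos.2 (qShiftInf_self_pos hQ0 hQ1))
      (Real.sqrt_le_sqrt (qShiftInf_self_le_qShift hQ0 hQ1 _))
  · positivity

lemma abs_clebschGordan_zero_le (hq0 : 0 < q) (hq1 : q < 1) {m n : ℤ} (hm : 0 ≤ m) (hn : 0 ≤ n) :
    |clebschGordan q 0 m n| ≤ (Real.sqrt (qShiftInf (q ^ 2) (q ^ 2)))⁻¹ * q ^ (m * n) := by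
  obtain ⟨hQ0, hQ1⟩ := sq_pos_lt_one hq0 hq1
  have h := Real.sqrt_pos.2 (qShiftInf_self_pos hQ0 hQ1)
  have h1 := cgNorm_nonneg q m
  have h2 := cgNorm_nonneg q n
  rw [clebschGordan_zero_left hq0 hq1 hm hn, abs_of_nonneg (by positivity)]
  refine mul_le_mul_of_nonneg_right ?_ (by positivity)
  calc _ ≤ Real.sqrt (qShiftInf (q ^ 2) (q ^ 2)) * ((Real.sqrt (qShiftInf (q ^ 2) (q ^ 2)))⁻¹ *
        (Real.sqrt (qShiftInf (q ^ 2) (q ^ 2)))⁻¹) := by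
        gcongr
        · exact cgNorm_le hq0 hq1 m
        · exact cgNorm_le hq0 hq1 n
    _ = _ := by field_simp

lemma zpow_mul_le (hq0 : 0 < q) (hq1 : q < 1) {m n : ℤ} (hm : 0 ≤ m) (hn : 0 ≤ n) :
    q ^ (m * n) ≤ q ^ m.natAbs * (q ^ (m - n).natAbs)⁻¹ := by
  rw [← zpow_natCast, ← zpow_natCast, ← zpow_neg, ← zpow_add₀ hq0.ne']
  refine (zpow_le_zpow_iff_right_of_lt_one₀ hq0 hq1).2 ?_
  rcases hn.eq_or_lt with rfl | hn
  · simp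
  · have : 0 ≤ m * (n - 1) := mul_nonneg hm (by omega)
    have h2 : m * n = m * (n - 1) + m := by ring
    omega

lemma summable_abs_clebschGordan (hq0 : 0 < q) (hq1 : q < 1) (x p : ℤ) :
    Summable fun m : ℤ => |clebschGordan q x m (m - p)| := by
  by_cases hx : 0 ≤ x
  swap
  · simp [clebschGordan, hx, summable_zero]
  lift x to ℕ using hx
  induction x with
  | zero =>
    refine ((summable_pow_natAbs hq0 hq1).mul_left
      ((Real.sqrt (qShiftInf (q ^ 2) (q ^ 2)))⁻¹ * (q ^ p.natAbs)⁻¹)).of_nonneg_of_le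
      (fun _ => abs_nonneg _) fun m => ?_
    by_cases h : 0 ≤ m ∧ 0 ≤ m - p
    · refine (abs_clebschGordan_zero_le hq0 hq1 h.1 h.2).trans ?_
      have h1 := zpow_mul_le hq0 hq1 h.1 h.2
      rw [sub_sub_cancel] at h1
      calc _ ≤ (Real.sqrt (qShiftInf (q ^ 2) (q ^ 2)))⁻¹ *
            (q ^ m.natAbs * (q ^ p.natAbs)⁻¹) := by gcongr
        _ = _ := by ring
    · rw [clebschGordan_eq_zero (fun h' => h h'.2), abs_zero]
      positivity
  | succ x ih =>
    have hs := ladder_pos hq0 hq1 (show (0 : ℤ) < x + 1 by omega)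
    have ih' : Summable fun m : ℤ => |clebschGordan q x (m - 1) (m - p - 1)| := by
      have := ih.comp_injective (sub_left_injective (b := (1 : ℤ)))
      refine this.congr fun m => ?_
      simp only [Function.comp_apply]
      rw [show m - 1 - p = m - p - 1 by ring]
    refine ((ih'.add ih).mul_left (ladder q (x + 1))⁻¹).of_nonneg_of_le
      (fun _ => abs_nonneg _) fun m => ?_
    push_cast
    by_cases h : 0 ≤ m ∧ 0 ≤ m - p
    · rw [inv_mul_eq_div, le_div_iff₀ hs, mul_comm]
      -- The raising relation bounds level x + 1 by two summable sequences at level x, since all its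
      -- weights are at most 1 on nonnegative labels.
      rw [show ladder q (x + 1) * |clebschGordan q (x + 1) m (m - p)| =
          |ladder q (x + 1) * clebschGordan q (x + 1) m (m - p)| by rw [abs_mul, abs_of_pos hs],
        ← clebschGordan_raise hq0 hq1]
      refine (abs_sub _ _).trans (add_le_add ?_ ?_)
      · rw [abs_mul]
        refine mul_le_of_le_one_left (abs_nonneg _) ?_
        rw [abs_of_nonneg (mul_nonneg (ladder_nonneg _ _) (ladder_nonneg _ _))]
        exact mul_le_one₀ (ladder_le_one hq0 _) (ladder_nonneg _ _) (ladder_le_one hq0 _)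
      · rw [abs_mul]
        refine mul_le_of_le_one_left (abs_nonneg _) ?_
        rw [abs_of_nonneg (by positivity)]
        exact zpow_le_one₀ hq0 hq1.le (by omega)
    · rw [clebschGordan_eq_zero (fun h' => h h'.2), abs_zero]
      positivity

lemma Summable.mul_of_abs {ι : Type*} {f g : ι → ℝ} (hf : Summable fun i => |f i|)
    (hg : Summable fun i => |g i|) : Summable fun i => f i * g i := by
  refine Summable.of_norm_bounded (hf.mul_right (∑' j, |g j|)) fun i => ?_
  rw [norm_mul]
  exact mul_le_mul_of_nonneg_left (hg.le_tsum i fun _ _ => abs_nonneg _) (abs_nonneg _)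

lemma summable_clebschGordan_mul (hq0 : 0 < q) (hq1 : q < 1) (x x' p p' a : ℤ) :
    Summable fun m : ℤ =>
      clebschGordan q x m (m - p) * clebschGordan q x' (m + a) (m + a - p') :=
  (summable_abs_clebschGordan hq0 hq1 x p).mul_of_abs
    ((summable_abs_clebschGordan hq0 hq1 x' p').comp_injective (add_left_injective a))

/-- Expanding one factor of the first square by the γ relation, and one of the second by the γ*
relation, produces the same cross terms up to a shift of m. -/
lemma tsum_clebschGordan_zero_sq_succ (hq0 : 0 < q) (hq1 : q < 1) (p : ℤ) :
    ∑' m : ℤ, clebschGordan q 0 m (m - p) ^ 2 = ∑' m : ℤ, clebschGordan q 0 m (m - p + 1) ^ 2 := by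
  have hb (f : ℤ → ℝ) (hf : Summable f) (g : ℤ → ℝ)
      (hg : ∀ m, f m ≠ 0 → |g m| ≤ 1) : Summable fun m => g m * f m := by
    refine Summable.of_norm_bounded hf.norm fun m => ?_
    rw [norm_mul]
    by_cases h : f m = 0
    · simp [h]
    · exact mul_le_of_le_one_left (norm_nonneg _) (hg m h)
  have hg (a b : ℤ) (ha : 0 ≤ a) : |q ^ a * ladder q b| ≤ 1 := by
    rw [abs_of_nonneg (mul_nonneg (by positivity) (ladder_nonneg _ _))]
    exact mul_le_one₀ (zpow_le_one₀ hq0 hq1.le ha) (ladder_nonneg _ _) (ladder_le_one hq0 _)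
  set A : ℤ → ℝ := fun m => q ^ m * ladder q (m - p + 1) *
    (clebschGordan q 0 m (m - p) * clebschGordan q 0 m (m - p + 1)) with hA
  set B : ℤ → ℝ := fun m => q ^ (m - p) * ladder q m *
    (clebschGordan q 0 m (m - p) * clebschGordan q 0 (m - 1) (m - p)) with hB
  have hAs : Summable A := by
    refine hb _ ?_ _ fun m hm => hg _ _ ?_
    · simpa [sub_add] using summable_clebschGordan_mul hq0 hq1 0 0 p (p - 1) 0
    · by_contra h
      exact hm (by rw [clebschGordan_eq_zero (fun h' => h h'.2.1), zero_mul])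
  have hBs : Summable B := by
    refine hb _ ?_ _ fun m hm => hg _ _ ?_
    · refine (summable_clebschGordan_mul hq0 hq1 0 0 p (p - 1) (-1)).congr fun m => ?_
      rw [show m + -1 - (p - 1) = m - p by ring, ← sub_eq_add_neg]
    · by_contra h
      exact hm (by rw [clebschGordan_eq_zero (fun h' => h h'.2.2), zero_mul])
  have h1 : ∀ m : ℤ, clebschGordan q 0 m (m - p) ^ 2 = A m + B m := fun m => by
    have := clebschGordan_gamma hq0 hq1 0 m (m - p)
    rw [zpow_zero, one_mul] at this
    simp only [hA, hB]
    linear_combination -clebschGordan q 0 m (m - p) * this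
  have h2 : ∀ m : ℤ, clebschGordan q 0 m (m - p + 1) ^ 2 = A m + B (m + 1) := fun m => by
    have := clebschGordan_gamma' hq0 hq1 0 m (m - p + 1)
    rw [zpow_zero, one_mul, add_sub_cancel_right] at this
    simp only [hA, hB]
    rw [show m + 1 - p = m - p + 1 by ring, add_sub_cancel_right]
    linear_combination -clebschGordan q 0 m (m - p + 1) * this
  simp only [h1, h2]
  have e : ∑' m : ℤ, B (m + 1) = ∑' m, B m := (Equiv.addRight (1 : ℤ)).tsum_eq B
  have hBs' : Summable fun m : ℤ => B (m + 1) := hBs.comp_injective (add_left_injective (1 : ℤ))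
  rw [hAs.tsum_add hBs, hAs.tsum_add hBs', e]

/-- Only m = 0 survives, with value (q²;q²)_∞ / (q²;q²)_j → 1; terms with m > 0 are of order
q^{2m(m+j)}. With independence of p this fixes the norm. -/
lemma tendsto_tsum_clebschGordan_zero_sq (hq0 : 0 < q) (hq1 : q < 1) :
    Tendsto (fun j : ℕ => ∑' m : ℤ, clebschGordan q 0 m (m + j) ^ 2) atTop (𝓝 1) := by
  obtain ⟨hQ0, hQ1⟩ := sq_pos_lt_one hq0 hq1
  have hpos := qShiftInf_self_pos hQ0 hQ1
  have hle : ∀ m : ℤ, 0 ≤ m → ∀ j : ℕ, clebschGordan q 0 m (m + j) ^ 2 ≤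
      (qShiftInf (q ^ 2) (q ^ 2))⁻¹ * (q ^ 2) ^ (m * (m + j)) := fun m hm j => by
    rw [← sq_abs]
    refine (pow_le_pow_left₀ (abs_nonneg _)
      (abs_clebschGordan_zero_le hq0 hq1 hm (by omega)) 2).trans_eq ?_
    rw [mul_pow, inv_pow, Real.sq_sqrt hpos.le]
    congr 1
    rw [sq_zpow_eq, ← zpow_natCast, ← zpow_mul, mul_comm]
    rfl
  have h : Tendsto (fun j : ℕ => ∑' m : ℤ, clebschGordan q 0 m (m + j) ^ 2) atTop
      (𝓝 (∑' m : ℤ, if m = 0 then 1 else 0)) := by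
    refine tendsto_tsum_of_dominated_convergence
      ((summable_pow_natAbs hQ0 hQ1).mul_left (qShiftInf (q ^ 2) (q ^ 2))⁻¹) (fun m => ?_)
      (Eventually.of_forall fun j m => ?_)
    · rcases lt_trichotomy m 0 with hm | rfl | hm
      · simp [clebschGordan_eq_zero (q := q) (fun h' => not_le.2 hm h'.2.1), hm.ne]
      · have h1 := (tendsto_qShift hQ0 hQ1 (q ^ 2)).inv₀ hpos.ne'
        have h2 := h1.const_mul (qShiftInf (q ^ 2) (q ^ 2))
        rw [mul_inv_cancel₀ hpos.ne'] at h2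
        rw [if_pos rfl]
        refine h2.congr fun j => ?_
        rw [clebschGordan_zero_left hq0 hq1 le_rfl (by omega)]
        simp [cgNorm, qShift_zero, mul_pow, Real.sq_sqrt hpos.le,
          Real.sq_sqrt (qShift_self_pos hQ0 hQ1 j).le]
      · rw [if_neg hm.ne']
        have h1 := (tendsto_pow_atTop_nhds_zero_of_lt_one hQ0.le hQ1).const_mul
          (qShiftInf (q ^ 2) (q ^ 2))⁻¹
        rw [mul_zero] at h1
        refine squeeze_zero (fun _ => sq_nonneg _) (fun j => (hle m hm.le j).trans ?_) h1
        refine mul_le_mul_of_nonneg_left ?_ (by positivity)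
        rw [← zpow_natCast (q ^ 2) j]
        refine (zpow_le_zpow_iff_right_of_lt_one₀ hQ0 hQ1).2 ?_
        nlinarith
    · rw [Real.norm_of_nonneg (sq_nonneg _)]
      by_cases hm : 0 ≤ m
      · refine (hle m hm j).trans (mul_le_mul_of_nonneg_left ?_ (by positivity))
        rw [← zpow_natCast (q ^ 2) m.natAbs]
        refine (zpow_le_zpow_iff_right_of_lt_one₀ hQ0 hQ1).2 ?_
        rw [Int.natCast_natAbs, abs_of_nonneg hm]
        rcases hm.eq_or_lt with rfl | hm
        · simp
        · nlinarith
      · rw [clebschGordan_eq_zero (fun h' => hm h'.2.1), zero_pow two_ne_zero]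
        positivity
  rwa [tsum_ite_eq] at h

lemma tsum_clebschGordan_zero_sq (hq0 : 0 < q) (hq1 : q < 1) (p : ℤ) :
    ∑' m : ℤ, clebschGordan q 0 m (m - p) ^ 2 = 1 := by
  have h : ∀ j : ℕ, ∑' m : ℤ, clebschGordan q 0 m (m - p) ^ 2 =
      ∑' m : ℤ, clebschGordan q 0 m (m - (p - j)) ^ 2 := by
    intro j
    induction j with
    | zero => simp
    | succ j ih =>
      rw [ih, tsum_clebschGordan_zero_sq_succ hq0 hq1]
      push_cast
      refine tsum_congr fun m => ?_
      rw [show m - (p - (j + 1)) = m - (p - j) + 1 by ring]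
  -- Shifting by j + |p| rather than j makes the resulting offset j + |p| - p a natural number.
  have h2 := (tendsto_tsum_clebschGordan_zero_sq hq0 hq1).comp
    (tendsto_atTop_mono (fun j : ℕ => (by omega : j ≤ (j + p.natAbs - p).toNat)) tendsto_id)
  refine tendsto_nhds_unique (tendsto_const_nhds.congr fun j => ?_) h2
  rw [h (j + p.natAbs)]
  refine tsum_congr fun m => ?_
  rw [show m - (p - ((j + p.natAbs : ℕ) : ℤ)) = m + ((j + p.natAbs - p : ℤ).toNat : ℕ) by omega]

/-- Adjointness of α* and α: raising x and lowering x' give the same cross terms after shifting m.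
-/
lemma tsum_clebschGordan_mul_succ (hq0 : 0 < q) (hq1 : q < 1) (x x' p : ℤ) :
    ladder q (x + 1) *
        ∑' m : ℤ, clebschGordan q (x + 1) m (m - p) * clebschGordan q x' m (m - p) =
      ladder q x' * ∑' m : ℤ, clebschGordan q x m (m - p) * clebschGordan q (x' - 1) m (m - p) := by
  set A : ℤ → ℝ := fun m => ladder q m * ladder q (m - p) * (clebschGordan q x (m - 1) (m - p - 1) *
    clebschGordan q x' m (m - p)) with hA
  set B : ℤ → ℝ := fun m => q ^ (m + (m - p) + 1) *
    (clebschGordan q x m (m - p) * clebschGordan q x' m (m - p)) with hB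
  have hAs : Summable A := by
    have h := summable_clebschGordan_mul hq0 hq1 x' x p p (-1)
    refine Summable.of_norm_bounded h.norm fun m => ?_
    rw [hA, norm_mul, mul_comm (clebschGordan q x _ _), show m + -1 - p = m - p - 1 by ring,
      ← sub_eq_add_neg]
    refine mul_le_of_le_one_left (norm_nonneg _) ?_
    rw [Real.norm_of_nonneg (mul_nonneg (ladder_nonneg _ _) (ladder_nonneg _ _))]
    exact mul_le_one₀ (ladder_le_one hq0 _) (ladder_nonneg _ _) (ladder_le_one hq0 _)
  have hBs : Summable B := by
    have h := summable_clebschGordan_mul hq0 hq1 x x' p p 0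
    simp only [add_zero] at h
    refine Summable.of_norm_bounded h.norm fun m => ?_
    rw [hB, norm_mul]
    by_cases hm : 0 ≤ m ∧ 0 ≤ m - p
    · refine mul_le_of_le_one_left (norm_nonneg _) ?_
      rw [Real.norm_of_nonneg (by positivity)]
      exact zpow_le_one₀ hq0 hq1.le (by omega)
    · rw [clebschGordan_eq_zero (fun h' => hm h'.2)]
      simp
  have h1 : ∀ m : ℤ, ladder q (x + 1) *
      (clebschGordan q (x + 1) m (m - p) * clebschGordan q x' m (m - p)) = A m - B m := fun m => by
    simp only [hA, hB]
    linear_combination -clebschGordan q x' m (m - p) * clebschGordan_raise hq0 hq1 x m (m - p)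
  have h2 : ∀ m : ℤ, ladder q x' *
      (clebschGordan q x m (m - p) * clebschGordan q (x' - 1) m (m - p)) = A (m + 1) - B m :=
    fun m => by
    have := clebschGordan_lower hq0 hq1 x' m (m - p)
    simp only [hA, hB]
    rw [show m + 1 - p = m - p + 1 by ring, add_sub_cancel_right, add_sub_cancel_right]
    linear_combination -clebschGordan q x m (m - p) * this
  rw [← tsum_mul_left, ← tsum_mul_left]
  simp only [h1, h2]
  have e : ∑' m : ℤ, A (m + 1) = ∑' m, A m := (Equiv.addRight (1 : ℤ)).tsum_eq A
  have hAs' : Summable fun m : ℤ => A (m + 1) := hAs.comp_injective (add_left_injective (1 : ℤ))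
  rw [hAs.tsum_sub hBs, hAs'.tsum_sub hBs, e]

lemma tsum_clebschGordan_mul (hq0 : 0 < q) (hq1 : q < 1) (x : ℕ) (x' p : ℤ) :
    ∑' m : ℤ, clebschGordan q x m (m - p) * clebschGordan q x' m (m - p) =
      if (x : ℤ) = x' then 1 else 0 := by
  induction x generalizing x' with
  | zero =>
    rcases lt_trichotomy x' 0 with hx | rfl | hx
    · rw [if_neg (by push_cast; omega)]
      simp [clebschGordan_eq_zero (q := q) (x := x') (fun h' => not_le.2 hx h'.1)]
    · simpa [sq] using tsum_clebschGordan_zero_sq hq0 hq1 p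
    · rw [if_neg (by push_cast; omega)]
      have h := tsum_clebschGordan_mul_succ hq0 hq1 (x' - 1) 0 p
      rw [ladder_zero, zero_mul, sub_add_cancel] at h
      simp only [mul_comm (clebschGordan q x' _ _)] at h
      exact (mul_eq_zero.1 h).resolve_left (ladder_pos hq0 hq1 hx).ne'
  | succ x ih =>
    have h := tsum_clebschGordan_mul_succ hq0 hq1 x x' p
    have hs := (ladder_pos hq0 hq1 (show (0 : ℤ) < x + 1 by omega)).ne'
    rw [ih] at h
    push_cast
    by_cases hx : (x : ℤ) + 1 = x'
    · subst hx
      rw [if_pos (by ring)] at h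
      rw [if_pos rfl]
      exact mul_left_cancel₀ hs h
    · rw [if_neg (by omega), mul_zero] at h
      rw [if_neg hx]
      exact (mul_eq_zero.1 h).resolve_left hs

/-- The orthonormality relations of the Clebsch-Gordan coefficients. -/
theorem hasSum_clebschGordan_mul (hq0 : 0 < q) (hq1 : q < 1) {x : ℤ} (hx : 0 ≤ x) (x' p : ℤ) :
    HasSum (fun m : ℤ => clebschGordan q x m (m - p) * clebschGordan q x' m (m - p))
      (if x = x' then 1 else 0) := by
  lift x to ℕ using hx
  rw [← tsum_clebschGordan_mul hq0 hq1 x x' p]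
  have h := summable_clebschGordan_mul hq0 hq1 x x' p p 0
  simp only [add_zero] at h
  exact h.hasSum

theorem abs_clebschGordan_le_one (hq0 : 0 < q) (hq1 : q < 1) (x m n : ℤ) :
    |clebschGordan q x m n| ≤ 1 := by
  by_cases hx : 0 ≤ x
  · have h := hasSum_clebschGordan_mul hq0 hq1 hx x (m - n)
    have h2 := le_hasSum h m fun j _ => mul_self_nonneg _
    rw [if_pos rfl, sub_sub_cancel, ← abs_mul_abs_self] at h2
    nlinarith [abs_nonneg (clebschGordan q x m n)]
  · rw [clebschGordan_eq_zero (fun h' => hx h'.1)]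
    simp

end ClebschGordanOrthonormal

/-! ### The entire series of the Hahn-Exton function: symmetry, bounds, generating function. -/

section BesselSeries

variable {Q : ℝ}

/-- The terms of Euler's series for `(z;Q)_∞`. -/
noncomputable def eulerTerm (Q z : ℝ) (n : ℕ) : ℝ :=
  (-1) ^ n * Q ^ n.choose 2 * (qShift Q Q n)⁻¹ * z ^ n

/-- The series `∑ i, (-1)^i Q^{i(i-1)/2} A^i (B Q^i;Q)_∞ / (Q;Q)_i`. -/
noncomputable def besselSeries (Q A B : ℝ) : ℝ :=
  ∑' i : ℕ, eulerTerm Q A i * qShiftInf (B * Q ^ i) Q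

lemma eulerTerm_mul (Q z w : ℝ) (n : ℕ) : eulerTerm Q (z * w) n = eulerTerm Q z n * w ^ n := by
  rw [eulerTerm, eulerTerm, mul_pow]; ring

lemma summable_norm_eulerTerm (hQ0 : 0 < Q) (hQ1 : Q < 1) (z : ℝ) :
    Summable fun n => ‖eulerTerm Q z n‖ := summable_euler_two hQ0 hQ1 z

/-- Expanding the infinite product by Euler gives a double series whose only coupling between the
two indices is Q^{ij}. -/
lemma besselSeries_symm (hQ0 : 0 < Q) (hQ1 : Q < 1) (A B : ℝ) :
    besselSeries Q A B = besselSeries Q B A := by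
  have h1 : ∀ A B : ℝ, besselSeries Q A B =
      ∑' i : ℕ, ∑' j : ℕ, eulerTerm Q A i * eulerTerm Q B j * Q ^ (i * j) := by
    intro A B
    refine tsum_congr fun i => ?_
    rw [← (hasSum_euler_two hQ0 hQ1 (B * Q ^ i)).tsum_eq, ← tsum_mul_left]
    refine tsum_congr fun j => ?_
    change _ * eulerTerm Q _ j = _
    rw [eulerTerm_mul, ← pow_mul]
    ring
  have h2 : Summable fun p : ℕ × ℕ => eulerTerm Q A p.1 * eulerTerm Q B p.2 * Q ^ (p.1 * p.2) := by
    refine Summable.of_norm_bounded ((summable_norm_eulerTerm hQ0 hQ1 A).mul_of_nonneg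
      (summable_norm_eulerTerm hQ0 hQ1 B) (fun _ => norm_nonneg _) fun _ => norm_nonneg _)
      fun p => ?_
    rw [norm_mul, norm_mul, Real.norm_of_nonneg (pow_nonneg hQ0.le _)]
    exact mul_le_of_le_one_right (by positivity) (pow_le_one₀ hQ0.le hQ1.le)
  rw [h1, h1, ← h2.tsum_comm (f := fun i j => eulerTerm Q A i * eulerTerm Q B j * Q ^ (i * j))]
  refine tsum_congr fun i => tsum_congr fun j => ?_
  rw [mul_comm j i]
  ring

/-- A bound for Euler's series. -/
noncomputable def eulerBound (Q : ℝ) : ℝ := (qShiftInf Q Q)⁻¹ * ∑' n : ℕ, Q ^ n.choose 2 * 1 ^ n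

lemma abs_eulerTerm_le (hQ0 : 0 < Q) (hQ1 : Q < 1) (z : ℝ) (n : ℕ) :
    |eulerTerm Q z n| ≤ (qShiftInf Q Q)⁻¹ * (Q ^ n.choose 2 * |z| ^ n) :=
  abs_euler_two_le hQ0 hQ1 z n

lemma summable_pow_choose (hQ0 : 0 < Q) (hQ1 : Q < 1) :
    Summable fun n : ℕ => Q ^ n.choose 2 * (1 : ℝ) ^ n := by
  simpa using summable_pow_choose_two hQ0 hQ1 1

lemma abs_qShiftInf_pow_le_one (hQ0 : 0 < Q) (hQ1 : Q < 1) (n : ℕ) :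
    |qShiftInf (Q ^ (n + 1)) Q| ≤ 1 := by
  rw [abs_of_pos (qShiftInf_pow_pos hQ0 hQ1 n)]
  exact qShiftInf_pow_le_one hQ0 hQ1 n

lemma abs_besselSeries_le (hQ0 : 0 < Q) (hQ1 : Q < 1) {A : ℝ} (hA : |A| ≤ 1) (N : ℕ) :
    |besselSeries Q A (Q ^ (N + 1))| ≤ eulerBound Q := by
  have hc := qShiftInf_self_pos hQ0 hQ1
  rw [eulerBound, ← tsum_mul_left, ← Real.norm_eq_abs]
  refine tsum_of_norm_bounded ((summable_pow_choose hQ0 hQ1).mul_left _).hasSum fun i => ?_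
  rw [norm_mul, ← pow_add, show N + 1 + i = N + i + 1 by ring]
  refine (mul_le_of_le_one_right (norm_nonneg _) (abs_qShiftInf_pow_le_one hQ0 hQ1 _)).trans
    ((abs_eulerTerm_le hQ0 hQ1 A i).trans ?_)
  gcongr

lemma choose_two_add (f t : ℕ) : (f + t).choose 2 = f.choose 2 + t.choose 2 + f * t := by
  have h1 := two_mul_choose_two (f + t)
  have h2 := two_mul_choose_two f
  have h3 := two_mul_choose_two t
  zify
  push_cast at h1
  linarith [mul_comm (f : ℤ) t, (by ring : ((f : ℤ) + t) * (f + t - 1) =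
    f * (f - 1) + t * (t - 1) + 2 * (f * t))]

/-- After the arguments are exchanged, the products (Q^{1-f+j};Q)_∞ with j < f vanish. The series
starts at j = f, and its first power of Q is the gain. -/
lemma abs_besselSeries_neg_le (hQ0 : 0 < Q) (hQ1 : Q < 1) (f N : ℕ) :
    |besselSeries Q (Q ^ (1 - f : ℤ)) (Q ^ (N + 1))| ≤
      Q ^ (f.choose 2 + (N + 1) * f) * eulerBound Q := by
  have hc := qShiftInf_self_pos hQ0 hQ1
  rw [besselSeries_symm hQ0 hQ1, besselSeries]
  set F : ℕ → ℝ := fun j => eulerTerm Q (Q ^ (N + 1)) j * qShiftInf (Q ^ (1 - f : ℤ) * Q ^ j) Q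
    with hF
  have hzero : ∀ j, j < f → F j = 0 := fun j hj => by
    simp only [hF]
    rw [← zpow_natCast Q j, ← zpow_add₀ hQ0.ne', qShiftInf_zpow_eq_zero hQ0 (by omega), mul_zero]
  have hshift : ∑' j, F j = ∑' t, F (t + f) := by
    refine (Function.Injective.tsum_eq (add_left_injective f) fun j hj => ?_).symm
    have : f ≤ j := by
      by_contra h
      exact hj (hzero j (by omega))
    exact ⟨j - f, by simp; omega⟩
  rw [hshift, eulerBound, ← tsum_mul_left, ← tsum_mul_left, ← Real.norm_eq_abs]
  refine tsum_of_norm_bounded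
    (((summable_pow_choose hQ0 hQ1).mul_left _).mul_left _).hasSum fun t => ?_
  simp only [hF]
  rw [← zpow_natCast Q (t + f), ← zpow_add₀ hQ0.ne',
    show (1 - f : ℤ) + (t + f : ℕ) = (t + 1 : ℕ) by push_cast; ring, zpow_natCast, norm_mul]
  refine (mul_le_of_le_one_right (norm_nonneg _) (abs_qShiftInf_pow_le_one hQ0 hQ1 _)).trans
    ((abs_eulerTerm_le hQ0 hQ1 _ _).trans ?_)
  rw [abs_of_pos (by positivity), ← pow_mul, ← pow_add, add_comm t f, choose_two_add, one_pow,
    mul_one, mul_left_comm, ← pow_add]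
  refine mul_le_mul_of_nonneg_left (pow_le_pow_of_le_one hQ0.le hQ1.le ?_) (by positivity)
  rw [mul_add]
  omega

/-- The generating function of the series `besselSeries`. -/
theorem hasSum_besselSeries (hQ0 : 0 < Q) (hQ1 : Q < 1) (A : ℝ) (N : ℕ) :
    HasSum (fun z : ℕ => besselSeries Q (A * Q ^ z) (Q ^ (N + 1)) *
      ((qShift Q Q z)⁻¹ * (Q ^ (N + 1)) ^ z)) (qShiftInf A Q) := by
  have hlt : ∀ i : ℕ, |Q ^ (N + 1) * Q ^ i| < 1 := fun i => by
    rw [abs_of_pos (by positivity), ← pow_add]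
    exact pow_lt_one₀ hQ0.le hQ1 (by omega)
  set F : ℕ × ℕ → ℝ := fun p => eulerTerm Q A p.2 * (qShiftInf (Q ^ (N + 1) * Q ^ p.2) Q *
    ((qShift Q Q p.1)⁻¹ * (Q ^ (N + 1) * Q ^ p.2) ^ p.1)) with hF
  have hFs : Summable F := by
    refine Summable.of_norm_bounded (((summable_euler_one hQ0 hQ1 (hlt 0))).mul_of_nonneg
      (summable_norm_eulerTerm hQ0 hQ1 A) (fun _ => norm_nonneg _) fun _ => norm_nonneg _)
      fun p => ?_
    simp only [hF, norm_mul, norm_pow]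
    have h1 := abs_qShiftInf_pow_le_one hQ0 hQ1 (N + p.2)
    rw [show N + p.2 + 1 = N + 1 + p.2 by ring, pow_add Q (N + 1)] at h1
    rw [Real.norm_of_nonneg hQ0.le, mul_comm ‖eulerTerm Q A p.2‖]
    refine mul_le_mul_of_nonneg_right ?_ (norm_nonneg _)
    refine (mul_le_of_le_one_left (by positivity) h1).trans
      (mul_le_mul_of_nonneg_left ?_ (norm_nonneg _))
    refine pow_le_pow_left₀ (by positivity) (mul_le_mul_of_nonneg_left ?_ (by positivity)) _
    exact pow_le_pow_of_le_one hQ0.le hQ1.le (Nat.zero_le _)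
  have hfib : ∀ z : ℕ, ∑' i, F (z, i) = besselSeries Q (A * Q ^ z) (Q ^ (N + 1)) *
      ((qShift Q Q z)⁻¹ * (Q ^ (N + 1)) ^ z) := fun z => by
    rw [besselSeries, ← tsum_mul_right]
    refine tsum_congr fun i => ?_
    simp only [hF]
    rw [eulerTerm_mul, mul_pow (Q ^ (N + 1)), ← pow_mul, ← pow_mul, ← pow_mul, mul_comm i z]
    ring
  -- Summing over z first, Euler's series for the reciprocal cancels (Q^{N+1+i};Q)_∞ and leaves
  -- Euler's series for (A;Q)_∞.
  have hsw : ∑' z, ∑' i, F (z, i) = qShiftInf A Q := by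
    rw [← hFs.tsum_comm (f := fun z i => F (z, i)), ← (hasSum_euler_two hQ0 hQ1 A).tsum_eq]
    refine tsum_congr fun i => ?_
    simp only [hF]
    rw [tsum_mul_left, tsum_mul_left, tsum_euler_one hQ0 hQ1 (hlt i), mul_one]
    rfl
  have h := hFs.prod.hasSum
  rw [hsw] at h
  simpa only [hfib] using h

end BesselSeries

/-! ### The recoupling kernel and its uniform summability. -/

section BesselKernel

variable {q : ℝ}

/-- The coupling coefficient of three factors. -/
noncomputable def besselKernel (q : ℝ) (N e : ℤ) : ℝ := (-q) ^ e * qBessel N ((q ^ 2) ^ e) (q ^ 2)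

lemma qBesselNat_eq (hq0 : 0 < q) (hq1 : q < 1) (N : ℕ) (e : ℤ) :
    qBesselNat N ((q ^ 2) ^ e) (q ^ 2) = q ^ (e * N) * (qShiftInf (q ^ 2) (q ^ 2))⁻¹ *
      besselSeries (q ^ 2) ((q ^ 2) ^ (e + 1)) ((q ^ 2) ^ (N + 1)) := by
  obtain ⟨hQ0, hQ1⟩ := sq_pos_lt_one hq0 hq1
  have h1 : ((q ^ 2) ^ e) ^ ((N : ℝ) / 2) = q ^ (e * N) := by
    rw [sq_zpow_eq, mul_comm, zpow_mul, show ((2 : ℤ)) = ((2 : ℕ) : ℤ) by rfl, zpow_natCast,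
      ← Real.rpow_natCast, ← Real.rpow_mul (by positivity), zpow_mul, zpow_natCast,
      ← Real.rpow_natCast (q ^ e) N]
    congr 1
    push_cast
    ring
  rw [qBesselNat, h1, phi11, besselSeries]
  simp only [← tsum_mul_left]
  refine tsum_congr fun i => ?_
  rw [qShiftInf_eq_mul hQ0 hQ1 ((q ^ 2) ^ (N + 1)) i, qShift_zero_left, eulerTerm,
    zpow_add_one₀ hQ0.ne', mul_comm (q ^ 2) ((q ^ 2) ^ e)]
  have p1 := (qShift_pow_pos hQ0 hQ1 N i).ne'
  have p2 := (qShift_self_pos hQ0 hQ1 i).ne'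
  field_simp

lemma besselKernel_natCast (hq0 : 0 < q) (hq1 : q < 1) (N : ℕ) (e : ℤ) :
    besselKernel q N e = (-1) ^ e * q ^ (e * (N + 1)) * (qShiftInf (q ^ 2) (q ^ 2))⁻¹ *
      besselSeries (q ^ 2) ((q ^ 2) ^ (e + 1)) ((q ^ 2) ^ (N + 1)) := by
  rw [besselKernel, qBessel, if_pos (by omega), Int.toNat_natCast, qBesselNat_eq hq0 hq1,
    mul_add_one, zpow_add₀ hq0.ne', ← neg_one_mul q, mul_zpow]
  ring

/-- The sign and power in the definition of negative orders are exactly absorbed by the prefactor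
(-q)^e: negating the order is a translation in e. -/
lemma besselKernel_neg (hq0 : 0 < q) (N : ℕ) (e : ℤ) :
    besselKernel q (-N) e = besselKernel q N (e + N) := by
  rcases Nat.eq_zero_or_pos N with rfl | hN
  · simp
  have h1 : (q ^ 2) ^ ((N : ℝ) / 2) = q ^ N := by
    rw [← Real.rpow_natCast q 2, ← Real.rpow_mul hq0.le, ← Real.rpow_natCast q N]
    congr 1
    push_cast
    ring
  have h2 : (-q) ^ (N : ℤ) = (-1) ^ N * q ^ N := by
    rw [zpow_natCast, ← mul_pow, neg_one_mul]
  rw [besselKernel, besselKernel, qBessel, qBessel, if_neg (by omega), if_pos (by omega),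
    Int.natAbs_neg, Int.natAbs_natCast, Int.toNat_natCast, h1, zpow_add₀ (neg_ne_zero.2 hq0.ne'),
    h2, zpow_add₀ (by positivity), zpow_natCast (q ^ 2)]
  ring

lemma abs_besselKernel_natCast_le (hq0 : 0 < q) (hq1 : q < 1) (N : ℕ) (e : ℤ) :
    |besselKernel q N e| ≤
      (qShiftInf (q ^ 2) (q ^ 2))⁻¹ * eulerBound (q ^ 2) * q ^ e.natAbs := by
  obtain ⟨hQ0, hQ1⟩ := sq_pos_lt_one hq0 hq1
  have hc := qShiftInf_self_pos hQ0 hQ1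
  have hb : 0 ≤ eulerBound (q ^ 2) := (abs_nonneg _).trans
    (abs_besselSeries_le hQ0 hQ1 (A := 0) (by simp) 0)
  rw [besselKernel_natCast hq0 hq1, abs_mul, abs_mul, abs_mul, abs_zpow, abs_neg, abs_one, one_zpow,
    one_mul, abs_of_pos (by positivity : 0 < q ^ (e * (N + 1))), abs_of_pos (inv_pos.2 hc)]
  rcases le_total 0 e with he | he
  · lift e to ℕ using he
    have h1 : |besselSeries (q ^ 2) ((q ^ 2) ^ ((e : ℤ) + 1)) ((q ^ 2) ^ (N + 1))| ≤
        eulerBound (q ^ 2) := by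
      refine abs_besselSeries_le hQ0 hQ1 ?_ N
      rw [abs_of_pos (by positivity)]
      exact zpow_le_one₀ hQ0 hQ1.le (by omega)
    have h2 : q ^ ((e : ℤ) * (N + 1)) ≤ q ^ e := by
      rw [← zpow_natCast]
      refine (zpow_le_zpow_iff_right_of_lt_one₀ hq0 hq1).2 ?_
      nlinarith
    calc _ ≤ q ^ e * (qShiftInf (q ^ 2) (q ^ 2))⁻¹ * eulerBound (q ^ 2) := by gcongr
      _ = _ := by rw [Int.natAbs_natCast]; ring
  · obtain ⟨f, rfl⟩ : ∃ f : ℕ, e = -f := ⟨e.natAbs, by omega⟩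
    have h1 := abs_besselSeries_neg_le hQ0 hQ1 f N
    rw [neg_add_eq_sub, Int.natAbs_neg, Int.natAbs_natCast]
    -- The total exponent is f² + Nf, at least f for every N; the growth of the prefactor at
    -- negative e is beaten uniformly in the order.
    have h2 : q ^ (-(f : ℤ) * (N + 1)) * (q ^ 2) ^ (f.choose 2 + (N + 1) * f) ≤ q ^ f := by
      rw [← zpow_natCast (q ^ 2), sq_zpow_eq, ← zpow_add₀ hq0.ne', ← zpow_natCast q f]
      refine (zpow_le_zpow_iff_right_of_lt_one₀ hq0 hq1).2 ?_
      have h3 := two_mul_choose_two f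
      push_cast
      have : (0 : ℤ) ≤ f * N := by positivity
      have : (f : ℤ) ≤ f * f := by
        rcases Nat.eq_zero_or_pos f with rfl | hf
        · simp
        · nlinarith
      nlinarith
    calc _ ≤ q ^ (-(f : ℤ) * (N + 1)) * (qShiftInf (q ^ 2) (q ^ 2))⁻¹ *
          ((q ^ 2) ^ (f.choose 2 + (N + 1) * f) * eulerBound (q ^ 2)) := by gcongr
      _ = (q ^ (-(f : ℤ) * (N + 1)) * (q ^ 2) ^ (f.choose 2 + (N + 1) * f)) *
          ((qShiftInf (q ^ 2) (q ^ 2))⁻¹ * eulerBound (q ^ 2)) := by ring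
      _ ≤ q ^ f * ((qShiftInf (q ^ 2) (q ^ 2))⁻¹ * eulerBound (q ^ 2)) := by gcongr
      _ = _ := by ring

/-- The kernel is summable, with a bound that does not depend on the order. -/
theorem exists_besselKernel_bound (hq0 : 0 < q) (hq1 : q < 1) :
    ∃ B : ℝ, ∀ N t : ℤ, Summable (fun e : ℤ => |besselKernel q N (e + t)|) ∧
      ∑' e : ℤ, |besselKernel q N (e + t)| ≤ B := by
  set c := (qShiftInf (q ^ 2) (q ^ 2))⁻¹ * eulerBound (q ^ 2)
  have h : ∀ N : ℤ, ∃ s : ℤ, ∀ e, |besselKernel q N e| ≤ c * q ^ (e + s).natAbs := fun N => by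
    rcases le_total 0 N with hN | hN
    · lift N to ℕ using hN
      exact ⟨0, fun e => by simpa using abs_besselKernel_natCast_le hq0 hq1 N e⟩
    · obtain ⟨k, rfl⟩ : ∃ k : ℕ, N = -k := ⟨N.natAbs, by omega⟩
      exact ⟨k, fun e => by
        rw [besselKernel_neg hq0]; exact abs_besselKernel_natCast_le hq0 hq1 k _⟩
  -- Both the translation t and the shift s coming from negative orders disappear in a sum over all
  -- of ℤ.
  refine ⟨∑' m : ℤ, c * q ^ m.natAbs, fun N t => ?_⟩
  obtain ⟨s, hs⟩ := h N
  have h1 : Summable fun m : ℤ => c * q ^ m.natAbs := (summable_pow_natAbs hq0 hq1).mul_left c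
  have h2 : Summable fun e : ℤ => c * q ^ (e + t + s).natAbs := by
    simpa only [add_assoc] using! h1.comp_injective (add_left_injective (t + s))
  have h3 : Summable fun e : ℤ => |besselKernel q N (e + t)| :=
    h2.of_nonneg_of_le (fun _ => abs_nonneg _) fun e => hs _
  refine ⟨h3, (h3.tsum_le_tsum (fun e => hs _) h2).trans_eq ?_⟩
  simpa only [add_assoc] using! (Equiv.addRight (t + s)).tsum_eq fun m : ℤ => c * q ^ m.natAbs

end BesselKernel

/-! ### The recoupling formula, by induction on the labels. -/

section Recoupling

variable {q : ℝ}

/-- The terms of the recoupling formula for three factors. -/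
noncomputable def couplingTerm (q : ℝ) (x z b w y t : ℤ) : ℝ :=
  besselKernel q (x + b - w - z) (y - w + t - z) * (clebschGordan q x t w * clebschGordan q t z b)

/-- The recoupling formula for three factors. -/
def Recoupling (q : ℝ) (x z b w y : ℤ) : Prop :=
  HasSum (couplingTerm q x z b w y) (clebschGordan q x z y * clebschGordan q y b w)

lemma HasSum.of_eq {ι : Type*} {f g : ι → ℝ} {a b : ℝ} (h : HasSum f a) (hg : ∀ i, g i = f i)
    (hb : b = a) : HasSum g b := by
  rwa [funext hg, hb]

lemma cgNorm_zero (q : ℝ) : cgNorm q 0 = 1 := by simp [cgNorm, qShift_zero]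

lemma cgNorm_sq (hq0 : 0 < q) (hq1 : q < 1) (n : ℕ) :
    cgNorm q n ^ 2 = (qShift (q ^ 2) (q ^ 2) n)⁻¹ := by
  obtain ⟨hQ0, hQ1⟩ := sq_pos_lt_one hq0 hq1
  rw [cgNorm, if_pos (by omega), Int.toNat_natCast, inv_pow,
    Real.sq_sqrt (qShift_self_pos hQ0 hQ1 n).le]

/-- Each of x, z, b, w labels a vertex in both products, so a negative one kills both sides. -/
lemma recoupling_of_neg {x z b w : ℤ} (y : ℤ) (h : ¬ (0 ≤ x ∧ 0 ≤ z ∧ 0 ≤ b ∧ 0 ≤ w)) :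
    Recoupling q x z b w y := by
  have h1 : clebschGordan q x z y * clebschGordan q y b w = 0 := by
    by_contra h'
    have h2 := not_imp_comm.1 clebschGordan_eq_zero (left_ne_zero_of_mul h')
    have h3 := not_imp_comm.1 clebschGordan_eq_zero (right_ne_zero_of_mul h')
    omega
  have h4 : couplingTerm q x z b w y = 0 := by
    funext t
    by_contra h'
    have h2 := not_imp_comm.1 clebschGordan_eq_zero
      (left_ne_zero_of_mul (right_ne_zero_of_mul h'))
    have h3 := not_imp_comm.1 clebschGordan_eq_zero
      (right_ne_zero_of_mul (right_ne_zero_of_mul h'))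
    omega
  rw [Recoupling, h1, h4]
  exact hasSum_zero

/-- Here all coefficients are monomials up to norming, and the formula is the generating function at
A = q^{2(y+1)}. For y < 0 the product (A;q²)_∞ vanishes, as does the left side. -/
lemma recoupling_zero_zero_right (hq0 : 0 < q) (hq1 : q < 1) (N : ℕ) (y : ℤ) :
    Recoupling q 0 0 N 0 y := by
  obtain ⟨hQ0, hQ1⟩ := sq_pos_lt_one hq0 hq1
  have hc := qShiftInf_self_pos hQ0 hQ1
  have hsupp : ∀ t ∉ Set.range (Nat.cast : ℕ → ℤ), couplingTerm q 0 0 N 0 y t = 0 := fun t ht => by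
    rw [couplingTerm, clebschGordan_eq_zero (x := t) fun h' =>
      ht ⟨t.toNat, Int.toNat_of_nonneg h'.1⟩, mul_zero, mul_zero]
  rw [Recoupling, ← Nat.cast_injective.hasSum_iff hsupp]
  have h := (hasSum_besselSeries hQ0 hQ1 ((q ^ 2) ^ (y + 1)) N).mul_left
    ((-1) ^ y * q ^ (y * (N + 1)) * cgNorm q N)
  refine h.of_eq (fun t => ?_) ?_
  · have e1 : (-1 : ℝ) ^ (y + (t : ℤ)) * (-1) ^ (t : ℤ) = (-1) ^ y := by
      rw [zpow_add₀ (by norm_num), mul_assoc, ← mul_zpow]; simp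
    have e2 : q ^ ((y + t) * ((N : ℤ) + 1)) * q ^ ((t : ℤ) * (N + 1)) =
        q ^ (y * ((N : ℤ) + 1)) * ((q ^ 2) ^ (N + 1)) ^ t := by
      rw [← pow_mul, ← zpow_natCast (q ^ 2), sq_zpow_eq, ← zpow_add₀ hq0.ne', ← zpow_add₀ hq0.ne']
      congr 1; push_cast; ring
    have e3 : (q ^ 2) ^ (y + t + 1) = (q ^ 2) ^ (y + 1) * (q ^ 2) ^ t := by
      rw [← zpow_natCast (q ^ 2) t, ← zpow_add₀ hQ0.ne']; congr 1; ring
    simp only [Function.comp_apply, couplingTerm, zero_add, sub_zero]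
    rw [besselKernel_natCast hq0 hq1, clebschGordan_right_zero hq0 hq1, clebschGordan_symm,
      clebschGordan_right_zero hq0 hq1, cgNorm_zero, zpow_zero, e3, ← cgNorm_sq hq0 hq1]
    have e4 := Real.mul_self_sqrt hc.le
    generalize besselSeries _ _ _ = G
    calc _ = (qShiftInf (q ^ 2) (q ^ 2))⁻¹ * (Real.sqrt (qShiftInf (q ^ 2) (q ^ 2)) *
          Real.sqrt (qShiftInf (q ^ 2) (q ^ 2))) * ((-1 : ℝ) ^ (y + (t : ℤ)) * (-1) ^ (t : ℤ)) *
          (q ^ ((y + t) * ((N : ℤ) + 1)) * q ^ ((t : ℤ) * (N + 1))) * cgNorm q t ^ 2 *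
          cgNorm q N * G := by simp; ring
      _ = _ := by rw [e1, e2, e4, inv_mul_cancel₀ hc.ne']; ring
  · by_cases hy : 0 ≤ y
    · lift y to ℕ using hy
      rw [clebschGordan_symm, clebschGordan_right_zero hq0 hq1, clebschGordan_right_zero hq0 hq1,
        cgNorm_zero, show ((y : ℤ) + 1) = (y + 1 : ℕ) by push_cast; ring, zpow_natCast (q ^ 2)]
      have h1 := qShiftInf_self_eq hQ0 hQ1 y
      have h2 := cgNorm_sq hq0 hq1 y
      have h3 := Real.mul_self_sqrt hc.le
      have h4 : qShiftInf ((q ^ 2) ^ (y + 1)) (q ^ 2) =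
          qShiftInf (q ^ 2) (q ^ 2) * cgNorm q y ^ 2 := by
        have := (qShift_self_pos hQ0 hQ1 y).ne'
        rw [h2, h1]; field_simp
      rw [h4, ← h3]
      simp
      ring
    · rw [clebschGordan_eq_zero (fun h' => hy h'.2.2), qShiftInf_zpow_eq_zero hQ0 (by omega)]
      simp

lemma ladder_mul_clebschGordan_zero' (hq0 : 0 < q) (hq1 : q < 1) (m n : ℤ) :
    ladder q n * clebschGordan q 0 m n = q ^ m * clebschGordan q 0 m (n - 1) := by
  rw [clebschGordan_symm q 0 m n, clebschGordan_symm q 0 m (n - 1)]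
  exact ladder_mul_clebschGordan_zero hq0 hq1 n m

lemma HasSum.comp_sub_one {f : ℤ → ℝ} {a : ℝ} (h : HasSum f a) :
    HasSum (fun t => f (t - 1)) a := (Equiv.subRight (1 : ℤ)).hasSum_iff.2 h

/-- The α relation at C_{y,b+1,w+1} yields two terms. The order depends on b - w only, and raising w
is compensated by lowering t or y, so the kernel is common to all terms. -/
lemma recoupling_zero_zero_step (hq0 : 0 < q) (hq1 : q < 1) {b w y : ℤ} (hb : 0 ≤ b) (hw : 0 ≤ w)
    (h1 : Recoupling q 0 0 b w y) (h2 : Recoupling q 0 0 b w (y - 1)) :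
    Recoupling q 0 0 (b + 1) (w + 1) y := by
  have p1 := ladder_pos hq0 hq1 (show 0 < b + 1 by omega)
  have p2 := ladder_pos hq0 hq1 (show 0 < w + 1 by omega)
  rw [Recoupling, ← hasSum_mul_left_iff (mul_pos p1 p2).ne']
  have h := ((HasSum.comp_sub_one h1).mul_left (q ^ (b + w + 1))).add h2
  refine h.of_eq (fun t => ?_) ?_
  · have e1 : couplingTerm q 0 0 b w y (t - 1) =
        besselKernel q (0 + (b + 1) - (w + 1) - 0) (y - (w + 1) + t - 0) *
          (clebschGordan q 0 (t - 1) w * clebschGordan q (t - 1) 0 b) := by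
      unfold couplingTerm; congr 2 <;> ring
    have e2 : couplingTerm q 0 0 b w (y - 1) t =
        besselKernel q (0 + (b + 1) - (w + 1) - 0) (y - (w + 1) + t - 0) *
          (clebschGordan q 0 t w * clebschGordan q t 0 b) := by
      unfold couplingTerm; congr 2 <;> ring
    rw [e1, e2, couplingTerm]
    have r1 := ladder_mul_clebschGordan_zero' hq0 hq1 t (w + 1)
    have r2 := clebschGordan_gamma hq0 hq1 t 0 b
    have r3 := ladder_mul_clebschGordan_zero hq0 hq1 t w
    have r4 := clebschGordan_raise hq0 hq1 (t - 1) 0 b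
    rw [add_sub_cancel_right] at r1
    rw [ladder_zero, zpow_zero] at r2
    rw [ladder_zero, sub_add_cancel, zero_add, zpow_add_one₀ hq0.ne'] at r4
    have r5 : q ^ t * q ^ t * clebschGordan q 0 t w =
        (1 - ladder q t ^ 2) * clebschGordan q 0 t w := by
      by_cases ht : 0 ≤ t
      · rw [ladder_sq hq0 hq1 ht, sq_zpow_eq, two_mul, zpow_add₀ hq0.ne']; ring
      · rw [clebschGordan_eq_zero fun h' => ht h'.2.1]; simp
    rw [show b + w + 1 = w + b + 1 by ring, zpow_add_one₀ hq0.ne', zpow_add₀ hq0.ne']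
    generalize besselKernel q _ _ = M
    linear_combination M * (ladder q (b + 1) * clebschGordan q t 0 (b + 1) * r1 +
      q ^ t * clebschGordan q 0 t w * r2 + clebschGordan q t 0 b * r5 +
      q ^ b * q * clebschGordan q (t - 1) 0 b * r3 + ladder q t * clebschGordan q 0 t w * r4)
  · have r1 := clebschGordan_lower hq0 hq1 y b w
    have r2 := ladder_mul_clebschGordan_zero' hq0 hq1 0 y
    rw [zpow_zero] at r2
    linear_combination clebschGordan q 0 0 y * r1 + clebschGordan q (y - 1) b w * r2

lemma recoupling_zero_zero (hq0 : 0 < q) (hq1 : q < 1) (b w y : ℤ) :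
    Recoupling q 0 0 b w y := by
  by_cases h : 0 ≤ b ∧ 0 ≤ w
  swap
  · exact recoupling_of_neg y (by omega)
  obtain ⟨hb, hw⟩ := h
  lift b to ℕ using hb
  lift w to ℕ using hw
  induction b generalizing w y with
  | zero =>
    have h := recoupling_zero_zero_right hq0 hq1 w y
    rw [Recoupling, clebschGordan_symm q y] at h
    refine h.of_eq (fun t => ?_) rfl
    simp only [couplingTerm, Nat.cast_zero, zero_add, sub_zero, zero_sub]
    -- For b = 0 the order is -w; reflecting it leads back to the case with b and w exchanged, since
    -- C_{0,t,w} C_{t,0,0} = C_{0,t,0} C_{t,0,w}.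
    rw [besselKernel_neg hq0, show y - (w : ℤ) + t + w = y + t by ring]
    congr 1
    by_cases ht : 0 ≤ t
    · rw [clebschGordan_zero_left hq0 hq1 ht (by omega), clebschGordan_zero_left hq0 hq1 ht le_rfl,
        clebschGordan_symm q t 0 w, clebschGordan_right_zero hq0 hq1,
        clebschGordan_right_zero hq0 hq1]
      simp only [zero_add, mul_one, mul_zero, zpow_zero]
      rw [mul_add_one, zpow_add₀ hq0.ne']
      ring
    · rw [clebschGordan_eq_zero fun h' => ht h'.2.1, clebschGordan_eq_zero fun h' => ht h'.2.1]
      simp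
  | succ b ih =>
    cases w with
    | zero => exact recoupling_zero_zero_right hq0 hq1 _ y
    | succ w =>
      push_cast
      exact recoupling_zero_zero_step hq0 hq1 (by omega) (by omega) (ih y w) (ih (y - 1) w)

/-- At x = 0, lowering z + 1 costs a factor q^y, which the γ relation for C_{y,b,w} turns into
changes of b and w. Hence the induction on z runs over all b, w. -/
lemma recoupling_zero_step (hq0 : 0 < q) (hq1 : q < 1) {z b w y : ℤ} (hz : 0 ≤ z)
    (h1 : Recoupling q 0 z b (w + 1) y) (h2 : Recoupling q 0 z (b - 1) w y) :
    Recoupling q 0 (z + 1) b w y := by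
  have p1 := ladder_pos hq0 hq1 (show 0 < z + 1 by omega)
  rw [Recoupling, ← hasSum_mul_left_iff p1.ne']
  have h := (h1.mul_left (q ^ b * ladder q (w + 1))).add
    ((HasSum.comp_sub_one h2).mul_left (q ^ w * ladder q b))
  refine h.of_eq (fun t => ?_) ?_
  · have e1 : couplingTerm q 0 z b (w + 1) y t =
        besselKernel q (0 + b - w - (z + 1)) (y - w + t - (z + 1)) *
          (clebschGordan q 0 t (w + 1) * clebschGordan q t z b) := by
      unfold couplingTerm; congr 2 <;> ring
    have e2 : couplingTerm q 0 z (b - 1) w y (t - 1) =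
        besselKernel q (0 + b - w - (z + 1)) (y - w + t - (z + 1)) *
          (clebschGordan q 0 (t - 1) w * clebschGordan q (t - 1) z (b - 1)) := by
      unfold couplingTerm; congr 2 <;> ring
    rw [e1, e2, couplingTerm]
    have r1 := ladder_mul_clebschGordan_zero' hq0 hq1 t (w + 1)
    have r2 := clebschGordan_raise_left hq0 hq1 t (z + 1) b
    have r3 := ladder_mul_clebschGordan_zero hq0 hq1 t w
    rw [add_sub_cancel_right] at r1
    rw [add_sub_cancel_right, zpow_add₀ hq0.ne'] at r2
    generalize besselKernel q _ _ = M
    linear_combination M * (clebschGordan q 0 t w * r2 - q ^ b * clebschGordan q t z b * r1 +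
      ladder q b * clebschGordan q (t - 1) z (b - 1) * r3)
  · have r1 := ladder_mul_clebschGordan_zero hq0 hq1 (z + 1) y
    have r2 := clebschGordan_gamma hq0 hq1 y b w
    rw [add_sub_cancel_right] at r1
    linear_combination clebschGordan q y b w * r1 - clebschGordan q 0 z y * r2

lemma recoupling_zero (hq0 : 0 < q) (hq1 : q < 1) (z b w y : ℤ) : Recoupling q 0 z b w y := by
  by_cases hz : 0 ≤ z
  swap
  · exact recoupling_of_neg y (by omega)
  lift z to ℕ using hz
  induction z generalizing b w with
  | zero => exact recoupling_zero_zero hq0 hq1 b w y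
  | succ z ih =>
    push_cast
    exact recoupling_zero_step hq0 hq1 (by omega) (ih _ _) (ih _ _)

lemma recoupling_step (hq0 : 0 < q) (hq1 : q < 1) {x : ℤ} (hx : 0 ≤ x)
    (h : ∀ z b w y, Recoupling q x z b w y) (z b w y : ℤ) : Recoupling q (x + 1) z b w y := by
  have p1 := ladder_pos hq0 hq1 (show 0 < x + 1 by omega)
  rw [Recoupling, ← hasSum_mul_left_iff p1.ne']
  -- The α* relation for C_{x+1,z,y} leaves factors `ladder q y` and q^y; the α* and γ* relations
  -- for C_{y,b,w} split each in two, whence four terms with one kernel.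
  have h := ((((HasSum.comp_sub_one (h (z - 1) (b - 1) (w - 1) (y - 1))).mul_left
    (ladder q z * ladder q b * ladder q w)).sub
    ((HasSum.comp_sub_one (h z b (w - 1) y)).mul_left (ladder q w * q ^ (z + b + 1)))).sub
    ((h z (b + 1) w y).mul_left (q ^ (w + 1) * q ^ z * ladder q (b + 1)))).sub
    ((h (z - 1) b w (y - 1)).mul_left (q ^ (w + 1) * q ^ b * ladder q z))
  refine h.of_eq (fun t => ?_) ?_
  · have e1 : couplingTerm q x (z - 1) (b - 1) (w - 1) (y - 1) (t - 1) =
        besselKernel q (x + 1 + b - w - z) (y - w + t - z) *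
          (clebschGordan q x (t - 1) (w - 1) * clebschGordan q (t - 1) (z - 1) (b - 1)) := by
      unfold couplingTerm; congr 2 <;> ring
    have e2 : couplingTerm q x z b (w - 1) y (t - 1) =
        besselKernel q (x + 1 + b - w - z) (y - w + t - z) *
          (clebschGordan q x (t - 1) (w - 1) * clebschGordan q (t - 1) z b) := by
      unfold couplingTerm; congr 2 <;> ring
    have e3 : couplingTerm q x z (b + 1) w y t =
        besselKernel q (x + 1 + b - w - z) (y - w + t - z) *
          (clebschGordan q x t w * clebschGordan q t z (b + 1)) := by
      unfold couplingTerm; congr 2; ring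
    have e4 : couplingTerm q x (z - 1) b w (y - 1) t =
        besselKernel q (x + 1 + b - w - z) (y - w + t - z) *
          (clebschGordan q x t w * clebschGordan q t (z - 1) b) := by
      unfold couplingTerm; congr 2 <;> ring
    rw [e1, e2, e3, e4, couplingTerm]
    have r1 := clebschGordan_raise hq0 hq1 x t w
    have r2 := clebschGordan_raise hq0 hq1 (t - 1) z b
    have r3 := clebschGordan_gamma hq0 hq1 t z b
    rw [sub_add_cancel] at r2
    rw [add_assoc t, zpow_add₀ hq0.ne'] at r1
    generalize besselKernel q _ _ = M
    linear_combination M * (-clebschGordan q t z b * r1 -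
      ladder q w * clebschGordan q x (t - 1) (w - 1) * r2 +
      q ^ (w + 1) * clebschGordan q x t w * r3)
  · have r1 := clebschGordan_raise hq0 hq1 x z y
    have r2 := clebschGordan_raise hq0 hq1 (y - 1) b w
    have r3 := clebschGordan_gamma' hq0 hq1 y b w
    rw [sub_add_cancel] at r2
    have e1 : q ^ (z + y + 1) = q ^ z * q * q ^ y := by
      rw [zpow_add_one₀ hq0.ne', zpow_add₀ hq0.ne']; ring
    have e2 : q ^ (b + w + 1) = q ^ b * q ^ w * q := by
      rw [zpow_add_one₀ hq0.ne', zpow_add₀ hq0.ne']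
    have e3 : q ^ (z + b + 1) = q ^ z * q ^ b * q := by
      rw [zpow_add_one₀ hq0.ne', zpow_add₀ hq0.ne']
    rw [e1] at r1
    rw [e2] at r2
    rw [e3, zpow_add_one₀ hq0.ne']
    linear_combination -clebschGordan q y b w * r1 -
      ladder q z * clebschGordan q x (z - 1) (y - 1) * r2 +
      q ^ z * q * clebschGordan q x z y * r3

/-- The recoupling formula for three factors: the coefficients are `q`-Bessel functions. -/
theorem recoupling (hq0 : 0 < q) (hq1 : q < 1) (x z b w y : ℤ) : Recoupling q x z b w y := by
  by_cases hx : 0 ≤ x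
  swap
  · exact recoupling_of_neg y (by omega)
  lift x to ℕ using hx
  induction x generalizing z b w y with
  | zero => exact recoupling_zero hq0 hq1 z b w y
  | succ x ih =>
    push_cast
    exact recoupling_step hq0 hq1 (by omega) ih z b w y

end Recoupling

/-! ### Combs as iterated Clebsch-Gordan coefficients. -/

section Comb

variable {q : ℝ}

/-- Coordinates of a right comb with root `y`.  The parameter `c` collects the alternating sums
of the labels at the inner nodes. -/
noncomputable def combCoord (q : ℝ) : (m : ℕ) → ℤ → (Fin m → ℤ) → (Fin (m + 1) → ℕ) → ℝ
  | 0, y, _, a => if y = a 0 then 1 else 0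
  | m + 1, y, c, a => clebschGordan q y (a 0) (c 0 + a 0 - y) *
      combCoord q m (c 0 + a 0 - y) (Fin.tail c) (Fin.tail a)

lemma combCoord_succ_cons (m : ℕ) (y : ℤ) (c : Fin (m + 1) → ℤ) (a₀ : ℕ) (a : Fin (m + 1) → ℕ) :
    combCoord q (m + 1) y c (Fin.cons (α := fun _ => ℕ) a₀ a) =
      clebschGordan q y a₀ (c 0 + a₀ - y) * combCoord q m (c 0 + a₀ - y) (Fin.tail c) a := by
  rw [combCoord, Fin.cons_zero, Fin.tail_cons]

lemma hasSum_clebschGordan_nat (hq0 : 0 < q) (hq1 : q < 1) {x : ℤ} (hx : 0 ≤ x) (x' c : ℤ) :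
    HasSum (fun m : ℕ => clebschGordan q x m (c + m - x) * clebschGordan q x' m (c + m - x))
      (if x = x' then 1 else 0) := by
  have h := hasSum_clebschGordan_mul hq0 hq1 hx x' (x - c)
  rw [← Nat.cast_injective.hasSum_iff] at h
  · refine h.of_eq (fun m => ?_) rfl
    simp only [Function.comp_apply]
    rw [show (m : ℤ) - (x - c) = c + m - x by ring]
  · intro m hm
    rw [clebschGordan_eq_zero fun h' => hm ⟨m.toNat, Int.toNat_of_nonneg h'.2.1⟩, zero_mul]

lemma Summable.mul_of_sq {ι : Type*} {f g : ι → ℝ} (hf : Summable fun i => f i * f i)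
    (hg : Summable fun i => g i * g i) : Summable fun i => f i * g i := by
  refine Summable.of_norm_bounded (hf.add hg) fun i => ?_
  rw [Real.norm_eq_abs, abs_le]
  constructor <;> nlinarith [mul_self_nonneg (f i + g i), mul_self_nonneg (f i - g i),
    mul_self_nonneg (f i), mul_self_nonneg (g i)]

/-- Combs with the same number of leaves are orthonormal. -/
theorem hasSum_combCoord_mul (hq0 : 0 < q) (hq1 : q < 1) (m : ℕ) {y y' : ℤ} (hy : 0 ≤ y)
    (hy' : 0 ≤ y') (c c' : Fin m → ℤ) :
    HasSum (fun a => combCoord q m y c a * combCoord q m y' c' a)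
      (if y = y' ∧ c = c' then 1 else 0) := by
  induction m generalizing y y' with
  | zero =>
    have h := hasSum_single (f := fun a : Fin 1 → ℕ => combCoord q 0 y c a * combCoord q 0 y' c' a)
      (fun _ => y.toNat) fun a ha => by
        have : y ≠ a 0 := fun h => ha <| funext fun i => by
          rw [Subsingleton.elim i 0]; omega
        simp [combCoord, this]
    refine h.of_eq (fun _ => rfl) ?_
    simp only [combCoord, Int.toNat_of_nonneg hy, Subsingleton.elim c c', and_true, if_true, one_mul,
      eq_comm]
  | succ m ih =>
    rw [← (Fin.consEquiv fun _ : Fin (m + 2) => ℕ).hasSum_iff]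
    set F : ℤ → (Fin (m + 1) → ℤ) → ℕ × (Fin (m + 1) → ℕ) → ℝ := fun y c p =>
      clebschGordan q y p.1 (c 0 + p.1 - y) * combCoord q m (c 0 + p.1 - y) (Fin.tail c) p.2 with hF
    have hcons : ((fun a => combCoord q (m + 1) y c a * combCoord q (m + 1) y' c' a) ∘
        Fin.consEquiv fun _ : Fin (m + 2) => ℕ) = fun p => F y c p * F y' c' p := by
      funext p
      change combCoord q (m + 1) y c (Fin.cons (α := fun _ => ℕ) p.1 p.2) *
        combCoord q (m + 1) y' c' (Fin.cons (α := fun _ => ℕ) p.1 p.2) = _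
      simp only [combCoord_succ_cons, hF]
    rw [hcons]
    -- The next nodes are c 0 + a₀ - y and c' 0 + a₀ - y', so whether they agree is independent of
    -- a₀. If one is negative, a Clebsch-Gordan coefficient vanishes and the induction hypothesis is
    -- not needed.
    have hfib : ∀ {y y' : ℤ} (c c' : Fin (m + 1) → ℤ), 0 ≤ y → 0 ≤ y' → ∀ a₀ : ℕ,
        HasSum (fun a => F y c (a₀, a) * F y' c' (a₀, a))
          (if c 0 - y = c' 0 - y' ∧ Fin.tail c = Fin.tail c' then
            clebschGordan q y a₀ (c 0 + a₀ - y) * clebschGordan q y' a₀ (c 0 + a₀ - y) else 0) := by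
      intro y y' c c' hy hy' a₀
      by_cases hu : 0 ≤ c 0 + a₀ - y ∧ 0 ≤ c' 0 + a₀ - y'
      · have h := (ih hu.1 hu.2 (Fin.tail c) (Fin.tail c')).mul_left
          (clebschGordan q y a₀ (c 0 + a₀ - y) * clebschGordan q y' a₀ (c' 0 + a₀ - y'))
        refine h.of_eq (fun a => by simp only [hF]; ring) ?_
        by_cases hc : c 0 - y = c' 0 - y' ∧ Fin.tail c = Fin.tail c'
        · rw [if_pos hc, if_pos ⟨by omega, hc.2⟩, mul_one,
            show c' 0 + (a₀ : ℤ) - y' = c 0 + a₀ - y by omega]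
        · rw [if_neg hc, if_neg fun h' => hc ⟨by omega, h'.2⟩, mul_zero]
      · have h0 : clebschGordan q y a₀ (c 0 + a₀ - y) *
            clebschGordan q y' a₀ (c' 0 + a₀ - y') = 0 := by
          by_contra h'
          have h2 := not_imp_comm.1 clebschGordan_eq_zero (left_ne_zero_of_mul h')
          have h3 := not_imp_comm.1 clebschGordan_eq_zero (right_ne_zero_of_mul h')
          omega
        refine hasSum_zero.of_eq (fun a => ?_) ?_
        · simp only [hF]
          linear_combination combCoord q m (c 0 + a₀ - y) (Fin.tail c) a *
            combCoord q m (c' 0 + a₀ - y') (Fin.tail c') a * h0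
        · split_ifs with hc
          · rw [← h0, show c' 0 + (a₀ : ℤ) - y' = c 0 + a₀ - y by omega]
          · rfl
    have hsq : ∀ {y : ℤ} (c : Fin (m + 1) → ℤ), 0 ≤ y → Summable fun p => F y c p * F y c p := by
      intro y c hy
      refine (summable_prod_of_nonneg fun p => mul_self_nonneg _).2
        ⟨fun a₀ => (hfib c c hy hy a₀).summable, ?_⟩
      refine (hasSum_clebschGordan_nat hq0 hq1 hy y (c 0)).summable.congr fun a₀ => ?_
      rw [(hfib c c hy hy a₀).tsum_eq, if_pos ⟨rfl, rfl⟩]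
    -- Joint summability comes from the diagonal case, where the terms are nonnegative and fibrewise
    -- sums suffice.
    have hs : Summable fun p => F y c p * F y' c' p := (hsq c hy).mul_of_sq (hsq c' hy')
    have h1 := hs.hasSum.prod_fiberwise (hfib c c' hy hy')
    convert hs.hasSum using 1
    refine HasSum.unique ?_ h1
    by_cases hc : c 0 - y = c' 0 - y' ∧ Fin.tail c = Fin.tail c'
    · simp only [if_pos hc]
      refine (hasSum_clebschGordan_nat hq0 hq1 hy y' (c 0)).of_eq (fun _ => rfl) ?_
      refine if_congr ⟨fun h => h.1, fun h => ⟨h, ?_⟩⟩ rfl rfl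
      rw [← Fin.cons_self_tail c, ← Fin.cons_self_tail c', hc.2, show c 0 = c' 0 by omega]
    · simp only [if_neg hc]
      rw [if_neg]
      · exact hasSum_zero
      · rintro ⟨rfl, rfl⟩
        exact hc ⟨rfl, rfl⟩

/-- A comb in terms of its node labels. -/
lemma combCoord_eq (m : ℕ) (R n : Fin (m + 1) → ℤ) (a : Fin (m + 1) → ℕ) (D : ℕ → ℤ)
    (hD : ∀ j : Fin m, D (j + 1) = (a j.castSucc - n j.castSucc) - D j) :
    combCoord q m (R 0 + D 0) (fun j => R j.castSucc + R j.succ - n j.castSucc) a =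
      if R (Fin.last m) + D m = a (Fin.last m) then
        ∏ j : Fin m, clebschGordan q (R j.castSucc + D j) (a j.castSucc) (R j.succ + D (j + 1))
      else 0 := by
  induction m generalizing D with
  | zero => simp [combCoord]
  | succ m ih =>
    have h0 := hD 0
    simp only [Fin.val_zero, zero_add, Fin.castSucc_zero] at h0
    have e : R (Fin.castSucc 0) + R (Fin.succ 0) - n (Fin.castSucc 0) + a 0 - (R 0 + D 0) =
        R (Fin.succ 0) + D 1 := by
      rw [h0, Fin.castSucc_zero]; ring
    have h := ih (Fin.tail R) (Fin.tail n) (Fin.tail a) (fun j => D (j + 1)) fun j => by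
      have := hD j.succ
      simpa [Fin.tail, ← Fin.succ_castSucc] using this
    rw [combCoord, e, Fin.prod_univ_succ]
    change _ * combCoord q m (Fin.tail R 0 + D (0 + 1))
      (fun j => Fin.tail R j.castSucc + Fin.tail R j.succ - Fin.tail n j.castSucc) _ = _
    rw [h, mul_ite, mul_zero]
    rfl

end Comb

/-! ### The two families of trees as combs. -/

section Trees

variable {q : ℝ} {k : ℕ}

lemma labelShift_succ {N : ℕ} (n : Fin N → ℤ) (a : Fin N → ℕ) (j : Fin N) :
    labelShift n a (j + 1) = (a j - n j) - labelShift n a j := by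
  rw [labelShift, dif_pos j.isLt]

/-- The sums of adjacent node labels determine the labels, given the first one. -/
lemma eq_of_adjacent_sums {m : ℕ} {R R' : Fin (m + 1) → ℤ} (h0 : R 0 = R' 0)
    (h : ∀ j : Fin m, R j.castSucc + R j.succ = R' j.castSucc + R' j.succ) : R = R' := by
  funext i
  induction i using Fin.induction with
  | zero => exact h0
  | succ j ih =>
    have := h j
    omega

lemma rightTreeCoord_eq (x : ℤ) (r : Fin k → ℤ) (n : Fin (k + 2) → ℤ) (a : Fin (k + 2) → ℕ) :
    rightTreeCoord q x r n a =
      combCoord q (k + 1) x (fun j =>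
        (Fin.cons (α := fun _ => ℤ) x (Fin.snoc (α := fun _ => ℤ) r (n (Fin.last (k + 1)))) :
          Fin (k + 2) → ℤ) j.castSucc +
        (Fin.cons (α := fun _ => ℤ) x (Fin.snoc (α := fun _ => ℤ) r (n (Fin.last (k + 1)))) :
          Fin (k + 2) → ℤ) j.succ - n j.castSucc) a := by
  set R : Fin (k + 2) → ℤ :=
    Fin.cons (α := fun _ => ℤ) x (Fin.snoc (α := fun _ => ℤ) r (n (Fin.last (k + 1)))) with hR
  have h := combCoord_eq (q := q) (k + 1) R n a (labelShift n a)
    fun j => labelShift_succ n a j.castSucc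
  have hR0 : R 0 + labelShift n a 0 = x := by simp [hR, labelShift]
  have hRl : R (Fin.last (k + 1)) = n (Fin.last (k + 1)) := by
    rw [hR, ← Fin.succ_last, Fin.cons_succ, Fin.snoc_last]
  rw [hR0, hRl] at h
  rw [h, rightTreeCoord]
  have hl : labelShift n a (k + 2) = (a (Fin.last (k + 1)) - n (Fin.last (k + 1))) -
    labelShift n a (k + 1) := labelShift_succ n a (Fin.last (k + 1))
  refine if_congr ?_ rfl rfl
  omega

lemma leftTreeCoord_eq (x : ℤ) (s : Fin k → ℤ) (n : Fin (k + 2) → ℤ) (a : Fin (k + 2) → ℕ) :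
    leftTreeCoord q x s n a =
      combCoord q (k + 1) x (fun j =>
        (Fin.cons (α := fun _ => ℤ) (n 0) (Fin.snoc (α := fun _ => ℤ) s x) : Fin (k + 2) → ℤ)
          j.castSucc.rev +
        (Fin.cons (α := fun _ => ℤ) (n 0) (Fin.snoc (α := fun _ => ℤ) s x) : Fin (k + 2) → ℤ)
          j.succ.rev - n j.castSucc.rev) (fun i => a i.rev) := by
  set S : Fin (k + 2) → ℤ := Fin.cons (α := fun _ => ℤ) (n 0) (Fin.snoc (α := fun _ => ℤ) s x)
    with hS
  set d := labelShift n a (k + 2) with hd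
  -- The left comb is read from its root, with leaves reversed. The correction (-1)^j d solves the
  -- homogeneous recurrence and makes the root shift 0; the terminal condition of the comb then
  -- becomes (-1)^{k+1} d = 0, which is the support condition.
  have h := combCoord_eq (q := q) (k + 1) (fun i => S i.rev) (fun i => n i.rev) (fun i => a i.rev)
    (fun j => labelShift n a (k + 2 - j) - (-1) ^ j * d) fun j => by
      have h1 := labelShift_succ n a j.castSucc.rev
      have h2 : (j.castSucc.rev : ℕ) = k + 2 - (j + 1) := by simp
      have h3 : (j.castSucc.rev : ℕ) + 1 = k + 2 - j := by rw [h2]; omega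
      rw [h3, h2] at h1
      rw [h1, pow_succ]
      ring
  have hS0 : S (Fin.rev 0) + (labelShift n a (k + 2 - 0) - (-1) ^ 0 * d) = x := by
    rw [Fin.rev_zero, hS, ← Fin.succ_last, Fin.cons_succ, Fin.snoc_last, pow_zero, Nat.sub_zero]
    ring
  have hSl : S (Fin.last (k + 1)).rev = n 0 := by rw [Fin.rev_last, hS, Fin.cons_zero]
  have h1 : labelShift n a 1 = a 0 - n 0 := by
    simp [labelShift]
  rw [hS0, hSl, show k + 2 - (k + 1) = 1 by omega, h1, Fin.rev_last] at h
  rw [h, leftTreeCoord]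
  by_cases hd0 : d = 0
  · rw [if_pos hd0, hd0, if_pos (by ring), ← Equiv.prod_comp Fin.revPerm]
    refine Finset.prod_congr rfl fun j _ => ?_
    simp only [Fin.revPerm_apply, Fin.rev_castSucc, Fin.rev_succ, mul_zero, sub_zero]
    rw [clebschGordan_symm]
    have h2 : (j.rev : ℕ) + 2 = k + 2 - j := by rw [Fin.val_rev]; omega
    have h3 : (j.rev : ℕ) + 1 = k + 2 - (j + 1) := by rw [Fin.val_rev]; omega
    rw [h2, h3]
  · rw [if_neg hd0, if_neg]
    intro h'
    have : (-1 : ℤ) ^ (k + 1) * d = 0 := by linarith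
    exact hd0 ((mul_eq_zero.1 this).resolve_left (pow_ne_zero _ (by norm_num)))

/-- The right comb trees have orthonormal coordinates. -/
theorem hasSum_rightTreeCoord_mul (hq0 : 0 < q) (hq1 : q < 1) {x : ℤ} (hx : 0 ≤ x)
    (n : Fin (k + 2) → ℤ) (r r' : Fin k → ℤ) :
    HasSum (fun a => rightTreeCoord q x r n a * rightTreeCoord q x r' n a)
      (if r = r' then 1 else 0) := by
  simp only [rightTreeCoord_eq]
  refine (hasSum_combCoord_mul hq0 hq1 (k + 1) hx hx _ _).of_eq (fun _ => rfl) ?_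
  refine if_congr ⟨fun h => ⟨rfl, by rw [h]⟩, fun h => ?_⟩ rfl rfl
  have h1 := eq_of_adjacent_sums (R := Fin.cons (α := fun _ => ℤ) x
      (Fin.snoc (α := fun _ => ℤ) r (n (Fin.last (k + 1)))))
    (R' := Fin.cons (α := fun _ => ℤ) x
      (Fin.snoc (α := fun _ => ℤ) r' (n (Fin.last (k + 1))))) (by simp) fun j => by
        have := congrFun h.2 j
        linarith
  exact (Fin.snoc_inj.1 (Fin.cons_inj.1 h1).2).1

/-- The left comb trees have orthonormal coordinates. -/
theorem hasSum_leftTreeCoord_mul (hq0 : 0 < q) (hq1 : q < 1) {x : ℤ} (hx : 0 ≤ x)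
    (n : Fin (k + 2) → ℤ) (s s' : Fin k → ℤ) :
    HasSum (fun a => leftTreeCoord q x s n a * leftTreeCoord q x s' n a)
      (if s = s' then 1 else 0) := by
  simp only [leftTreeCoord_eq]
  have h0 := hasSum_combCoord_mul hq0 hq1 (k + 1) hx hx
    (fun j => (Fin.cons (α := fun _ => ℤ) (n 0) (Fin.snoc (α := fun _ => ℤ) s x) :
        Fin (k + 2) → ℤ) j.castSucc.rev +
      (Fin.cons (α := fun _ => ℤ) (n 0) (Fin.snoc (α := fun _ => ℤ) s x) : Fin (k + 2) → ℤ)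
        j.succ.rev - n j.castSucc.rev)
    (fun j => (Fin.cons (α := fun _ => ℤ) (n 0) (Fin.snoc (α := fun _ => ℤ) s' x) :
        Fin (k + 2) → ℤ) j.castSucc.rev +
      (Fin.cons (α := fun _ => ℤ) (n 0) (Fin.snoc (α := fun _ => ℤ) s' x) : Fin (k + 2) → ℤ)
        j.succ.rev - n j.castSucc.rev)
  rw [← (Equiv.arrowCongr Fin.revPerm (Equiv.refl ℕ)).hasSum_iff] at h0
  refine h0.of_eq (fun _ => rfl) ?_
  refine if_congr ⟨fun h => ⟨rfl, by rw [h]⟩, fun h => ?_⟩ rfl rfl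
  have h1 := eq_of_adjacent_sums
    (R := fun i => (Fin.cons (α := fun _ => ℤ) (n 0) (Fin.snoc (α := fun _ => ℤ) s x) :
      Fin (k + 2) → ℤ) i.rev)
    (R' := fun i => (Fin.cons (α := fun _ => ℤ) (n 0) (Fin.snoc (α := fun _ => ℤ) s' x) :
      Fin (k + 2) → ℤ) i.rev) (by
        rw [Fin.rev_zero, ← Fin.succ_last, Fin.cons_succ, Fin.snoc_last, Fin.cons_succ,
          Fin.snoc_last]) fun j => by
        have := congrFun h.2 j
        simp only at this
        linarith
  have h2 : (Fin.cons (α := fun _ => ℤ) (n 0) (Fin.snoc (α := fun _ => ℤ) s x) :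
      Fin (k + 2) → ℤ) = Fin.cons (α := fun _ => ℤ) (n 0) (Fin.snoc (α := fun _ => ℤ) s' x) := by
    funext i
    simpa using congrFun h1 i.rev
  exact (Fin.snoc_inj.1 (Fin.cons_inj.1 h2).2).1

end Trees

/-! ### Inner products from real coordinates. -/

section Coordinates

variable {N : ℕ} {f g : (Fin N → ℕ) → ℝ}

lemma memℓp_of_summable_mul_self (hf : Summable fun a => f a * f a) :
    Memℓp (fun a => (f a : ℂ)) 2 := by
  refine memℓp_gen (hf.congr fun a => ?_)
  simp [sq]

lemma toTensorL2_apply (hf : Summable fun a => f a * f a) (a : Fin N → ℕ) :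
    toTensorL2 f a = (f a : ℂ) := by
  rw [toTensorL2, dif_pos (memℓp_of_summable_mul_self hf)]

lemma inner_toTensorL2 (hf : Summable fun a => f a * f a) (hg : Summable fun a => g a * g a)
    {c : ℝ} (h : HasSum (fun a => f a * g a) c) :
    inner ℂ (toTensorL2 f) (toTensorL2 g) = (c : ℂ) := by
  refine (lp.hasSum_inner (𝕜 := ℂ) (toTensorL2 f) (toTensorL2 g)).unique ?_
  have e : (fun a => inner ℂ (toTensorL2 f a) (toTensorL2 g a)) =
      fun a => ((f a * g a : ℝ) : ℂ) := by
    funext a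
    rw [toTensorL2_apply hf, toTensorL2_apply hg]
    simp [mul_comm]
  rw [e]
  exact Complex.hasSum_ofReal.2 h

end Coordinates

/-! ### Iterated recoupling from the right comb to the left comb. -/

section Expansion

variable {q : ℝ}

/-- The product of the recoupling coefficients of all rotations from the right to the left comb. -/
noncomputable def kernelProd (q : ℝ) {k : ℕ} (ν : Fin k → ℤ) (X : Fin (k + 1) → ℤ) (z₀ : ℤ)
    (z : Fin k → ℤ) : ℝ :=
  let L : Fin (k + 1) → ℤ := Fin.cons (α := fun _ => ℤ) z₀ z
  ∏ j : Fin k, besselKernel q (ν j - X j.succ - L j.castSucc)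
    (X j.castSucc - X j.succ + L j.succ - L j.castSucc)

/-- The coordinate of the left comb with first leaf `z₀`, other leaves `b` and inner nodes `z`. -/
noncomputable def leftProd (q : ℝ) {k : ℕ} (x z₀ : ℤ) (b : Fin (k + 1) → ℤ) (z : Fin k → ℤ) : ℝ :=
  let Z : Fin (k + 2) → ℤ := Fin.cons (α := fun _ => ℤ) z₀ (Fin.snoc (α := fun _ => ℤ) z x)
  ∏ j : Fin (k + 1), clebschGordan q (Z j.succ) (Z j.castSucc) (b j)

/-- The coordinate of the right comb with first leaf `z₀`, other leaves `b` and inner nodes `X`. -/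
noncomputable def rightProd (q : ℝ) {k : ℕ} (x z₀ : ℤ) (b X : Fin (k + 1) → ℤ) : ℝ :=
  clebschGordan q x z₀ (X 0) *
    ∏ j : Fin k, clebschGordan q (X j.castSucc) (b j.castSucc) (X j.succ)

lemma kernelProd_cons {k : ℕ} (ν : Fin (k + 1) → ℤ) (X : Fin (k + 2) → ℤ) (z₀ t : ℤ)
    (z : Fin k → ℤ) :
    kernelProd q ν X z₀ (Fin.cons (α := fun _ => ℤ) t z) =
      besselKernel q (ν 0 - X 1 - z₀) (X 0 - X 1 + t - z₀) *
        kernelProd q (Fin.tail ν) (Fin.tail X) t z := by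
  simp only [kernelProd, Fin.prod_univ_succ]
  rfl

lemma leftProd_cons {k : ℕ} (x z₀ : ℤ) (b : Fin (k + 2) → ℤ) (t : ℤ) (z : Fin k → ℤ) :
    leftProd q x z₀ b (Fin.cons (α := fun _ => ℤ) t z) =
      clebschGordan q t z₀ (b 0) * leftProd q x t (Fin.tail b) z := by
  simp only [leftProd, ← Fin.cons_snoc_eq_snoc_cons]
  rw [Fin.prod_univ_succ]
  rfl

lemma rightProd_succ {k : ℕ} (x z₀ : ℤ) (b X : Fin (k + 2) → ℤ) :
    rightProd q x z₀ b X = clebschGordan q x z₀ (X 0) * clebschGordan q (X 0) (b 0) (X 1) *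
      ∏ j : Fin k, clebschGordan q (Fin.tail X j.castSucc) (Fin.tail b j.castSucc)
        (Fin.tail X j.succ) := by
  rw [rightProd, Fin.prod_univ_succ, mul_assoc]
  rfl

lemma abs_leftProd_le_one (hq0 : 0 < q) (hq1 : q < 1) {k : ℕ} (x z₀ : ℤ) (b : Fin (k + 1) → ℤ)
    (z : Fin k → ℤ) : |leftProd q x z₀ b z| ≤ 1 := by
  rw [leftProd, Finset.abs_prod]
  exact Finset.prod_le_one (fun _ _ => abs_nonneg _) fun _ _ =>
    abs_clebschGordan_le_one hq0 hq1 _ _ _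

lemma consEquiv_int_apply {k : ℕ} (p : ℤ × (Fin k → ℤ)) :
    (Fin.consEquiv fun _ : Fin (k + 1) => ℤ) p = Fin.cons (α := fun _ => ℤ) p.1 p.2 := rfl

/-- The order and argument of each factor involve the previous summation variable, so the iterated
sum closes only with a bound uniform in all parameters. -/
lemma exists_kernelProd_bound (hq0 : 0 < q) (hq1 : q < 1) (k : ℕ) :
    ∃ B : ℝ, ∀ (ν : Fin k → ℤ) (X : Fin (k + 1) → ℤ) (z₀ : ℤ),
      Summable (fun z => |kernelProd q ν X z₀ z|) ∧ ∑' z, |kernelProd q ν X z₀ z| ≤ B := by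
  induction k with
  | zero =>
    refine ⟨1, fun ν X z₀ => ⟨(hasSum_fintype _).summable, ?_⟩⟩
    rw [tsum_fintype]
    simp [kernelProd]
  | succ k ih =>
    obtain ⟨B, hB⟩ := ih
    obtain ⟨A, hA⟩ := exists_besselKernel_bound hq0 hq1
    have hB0 : 0 ≤ B := (tsum_nonneg fun _ => abs_nonneg _).trans (hB 0 0 0).2
    refine ⟨A * B, fun ν X z₀ => ?_⟩
    obtain ⟨hs, hle⟩ := hA (ν 0 - X 1 - z₀) (X 0 - X 1 - z₀)
    set F : ℤ × (Fin k → ℤ) → ℝ := fun p =>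
      |besselKernel q (ν 0 - X 1 - z₀) (p.1 + (X 0 - X 1 - z₀))| *
        |kernelProd q (Fin.tail ν) (Fin.tail X) p.1 p.2| with hF
    have hcomp : (fun z => |kernelProd q ν X z₀ z|) ∘ (Fin.consEquiv fun _ : Fin (k + 1) => ℤ) =
        F := by
      funext p
      simp only [Function.comp_apply, consEquiv_int_apply, kernelProd_cons, abs_mul, hF]
      rw [show X 0 - X 1 + p.1 - z₀ = p.1 + (X 0 - X 1 - z₀) by ring]
    have hfib : ∀ t, Summable fun z => F (t, z) := fun t =>
      (hB (Fin.tail ν) (Fin.tail X) t).1.mul_left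
        |besselKernel q (ν 0 - X 1 - z₀) (t + (X 0 - X 1 - z₀))|
    have hfle : ∀ t, ∑' z, F (t, z) ≤
        |besselKernel q (ν 0 - X 1 - z₀) (t + (X 0 - X 1 - z₀))| * B := fun t => by
      simp only [hF, tsum_mul_left]
      exact mul_le_mul_of_nonneg_left (hB _ _ t).2 (abs_nonneg _)
    have hfs : Summable fun t => ∑' z, F (t, z) :=
      (hs.mul_right B).of_nonneg_of_le
        (fun t => tsum_nonneg fun z => mul_nonneg (abs_nonneg _) (abs_nonneg _)) hfle
    have hFs : Summable F := (summable_prod_of_nonneg fun p =>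
      mul_nonneg (abs_nonneg _) (abs_nonneg _)).2 ⟨hfib, hfs⟩
    refine ⟨?_, ?_⟩
    · rw [← (Fin.consEquiv fun _ : Fin (k + 1) => ℤ).summable_iff, hcomp]
      exact hFs
    · rw [← (Fin.consEquiv fun _ : Fin (k + 1) => ℤ).tsum_eq]
      change ∑' p, ((fun z => |kernelProd q ν X z₀ z|) ∘
        (Fin.consEquiv fun _ : Fin (k + 1) => ℤ)) p ≤ _
      rw [hcomp, hFs.tsum_prod' hfib]
      refine (hfs.tsum_le_tsum hfle (hs.mul_right B)).trans ?_
      rw [tsum_mul_right]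
      exact mul_le_mul_of_nonneg_right hle hB0

lemma summable_kernelProd (hq0 : 0 < q) (hq1 : q < 1) {k : ℕ} (ν : Fin k → ℤ)
    (X : Fin (k + 1) → ℤ) (z₀ : ℤ) : Summable fun z => |kernelProd q ν X z₀ z| := by
  obtain ⟨B, hB⟩ := exists_kernelProd_bound hq0 hq1 k
  exact (hB ν X z₀).1

/-- The pointwise expansion of a right comb into left combs. -/
theorem hasSum_kernelProd_mul_leftProd (hq0 : 0 < q) (hq1 : q < 1) {k : ℕ} (x z₀ : ℤ)
    (b X : Fin (k + 1) → ℤ) (hlast : X (Fin.last k) = b (Fin.last k)) :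
    HasSum (fun z => kernelProd q (fun j => x + b j.castSucc) X z₀ z * leftProd q x z₀ b z)
      (rightProd q x z₀ b X) := by
  induction k generalizing z₀ with
  | zero =>
    have h := hasSum_fintype (fun z : Fin 0 → ℤ =>
      kernelProd q (fun j => x + b j.castSucc) X z₀ z * leftProd q x z₀ b z)
    refine h.of_eq (fun _ => rfl) ?_
    have h0 : X 0 = b 0 := hlast
    simp [kernelProd, leftProd, rightProd, h0]
    rfl
  | succ k ih =>
    have hs : Summable fun z => kernelProd q (fun j => x + b j.castSucc) X z₀ z *
        leftProd q x z₀ b z := by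
      refine Summable.of_norm_bounded 
        (summable_kernelProd hq0 hq1 (fun j => x + b j.castSucc) X z₀) fun z => ?_
      rw [norm_mul]
      exact mul_le_of_le_one_right (norm_nonneg _) (abs_leftProd_le_one hq0 hq1 _ _ _ _)
    rw [← (Fin.consEquiv fun _ : Fin (k + 1) => ℤ).summable_iff] at hs
    rw [← (Fin.consEquiv fun _ : Fin (k + 1) => ℤ).hasSum_iff]
    -- With the first new node t fixed, the subtree joining z₀ and b 0 acts as a single leaf t, and
    -- the induction hypothesis applies to a comb with one leaf fewer.
    have hfib : ∀ t, HasSum (fun z => ((fun z => kernelProd q (fun j => x + b j.castSucc) X z₀ z *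
        leftProd q x z₀ b z) ∘ (Fin.consEquiv fun _ : Fin (k + 1) => ℤ)) (t, z))
        (besselKernel q (x + b 0 - X 1 - z₀) (X 0 - X 1 + t - z₀) * clebschGordan q t z₀ (b 0) *
          rightProd q x t (Fin.tail b) (Fin.tail X)) := fun t => by
      refine ((ih t (Fin.tail b) (Fin.tail X) hlast).mul_left
        (besselKernel q (x + b 0 - X 1 - z₀) (X 0 - X 1 + t - z₀) *
          clebschGordan q t z₀ (b 0))).of_eq (fun z => ?_) rfl
      simp only [Function.comp_apply, consEquiv_int_apply, kernelProd_cons, leftProd_cons]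
      change besselKernel q (x + b 0 - X 1 - z₀) (X 0 - X 1 + t - z₀) *
        kernelProd q (fun j => x + Fin.tail b j.castSucc) (Fin.tail X) t z * _ = _
      ring
    have h1 := hs.hasSum.prod_fiberwise hfib
    -- The remaining sum over t is one rotation at the root.
    have h2 := (recoupling hq0 hq1 x z₀ (b 0) (X 1) (X 0)).mul_right
      (∏ j : Fin k, clebschGordan q (Fin.tail X j.castSucc) (Fin.tail b j.castSucc)
        (Fin.tail X j.succ))
    rw [← rightProd_succ] at h2
    rw [(h2.of_eq (fun t => ?_) rfl).unique h1]
    · exact hs.hasSum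
    · rw [couplingTerm, rightProd]
      change _ * (clebschGordan q x t (X 1) * _) = _
      ring

end Expansion

/-! ### Coupling coefficients, norm convergence and the shift of the root. -/

section CouplingCoefficients

variable {q : ℝ} {k : ℕ}

/-- The product of recoupling coefficients between the trees with inner nodes `r` and `s`. -/
noncomputable def treeKernel (q : ℝ) (x : ℤ) (n : Fin (k + 2) → ℤ) (r s : Fin k → ℤ) : ℝ :=
  kernelProd q (fun j => x + n j.succ.castSucc)
    (Fin.snoc (α := fun _ => ℤ) r (n (Fin.last (k + 1)))) (n 0) s

lemma prod_zpow_sub_succ {c : ℝ} (hc : c ≠ 0) {m : ℕ} (f : Fin (m + 1) → ℤ) :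
    ∏ j : Fin m, c ^ (f j.castSucc - f j.succ) = c ^ (f 0 - f (Fin.last m)) := by
  induction m with
  | zero => simp
  | succ m ih =>
    rw [Fin.prod_univ_succ]
    have h := ih (Fin.tail f)
    change _ * ∏ j : Fin m, c ^ (Fin.tail f j.castSucc - Fin.tail f j.succ) = _
    rw [h, ← zpow_add₀ hc]
    congr 1
    simp [Fin.tail]

lemma shiftMiddle_first (n : Fin (k + 2) → ℤ) (t : ℤ) : shiftMiddle n t 0 = n 0 := by
  simp [shiftMiddle]

lemma shiftMiddle_last (n : Fin (k + 2) → ℤ) (t : ℤ) :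
    shiftMiddle n t (Fin.last (k + 1)) = n (Fin.last (k + 1)) := by
  simp [shiftMiddle]

lemma shiftMiddle_middle (n : Fin (k + 2) → ℤ) (t : ℤ) (j : Fin k) :
    shiftMiddle n t j.succ.castSucc = t + n j.succ.castSucc := by
  rw [shiftMiddle, if_neg, add_comm]
  rintro (h | h)
  · have := congrArg Fin.val h
    simp at this
  · have := congrArg Fin.val h
    have := j.isLt
    simp at *

lemma treeKernel_eq (hq0 : 0 < q) (h0 : 0 < k) (h1 : k - 1 < k) (x : ℤ) (n : Fin (k + 2) → ℤ)
    (r s : Fin k → ℤ) :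
    treeKernel q x n r s =
      (-q) ^ (r ⟨0, h0⟩ + s ⟨k - 1, h1⟩ - n 0 - n (Fin.last (k + 1))) *
        multiQBessel (shiftMiddle n x) r s (q ^ 2) := by
  obtain ⟨k, rfl⟩ : ∃ k', k = k' + 1 := ⟨k - 1, (Nat.sub_add_cancel h0).symm⟩
  have hq : -q ≠ 0 := neg_ne_zero.2 hq0.ne'
  set X : Fin (k + 2) → ℤ := Fin.snoc (α := fun _ => ℤ) r (n (Fin.last (k + 2))) with hX
  set L : Fin (k + 2) → ℤ := Fin.cons (α := fun _ => ℤ) (n 0) s with hL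
  -- The exponent of -q in each factor is a difference of consecutive values of X - L, so only the
  -- two ends survive in the product.
  have hprod : treeKernel q x n r s = (∏ j : Fin (k + 1),
      (-q) ^ ((X j.castSucc - L j.castSucc) - (X j.succ - L j.succ))) *
      multiQBessel (shiftMiddle n x) r s (q ^ 2) := by
    rw [treeKernel, kernelProd, multiQBessel, shiftMiddle_first, shiftMiddle_last,
      ← Finset.prod_mul_distrib]
    refine Finset.prod_congr rfl fun j _ => ?_
    rw [shiftMiddle_middle, besselKernel]
    congr 2
    simp only [hX, hL]
    ring
  rw [hprod, prod_zpow_sub_succ hq fun i => X i - L i]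
  congr 2
  have e1 : X 0 = r 0 := by
    rw [hX, ← Fin.castSucc_zero, Fin.snoc_castSucc]
  have e2 : X (Fin.last (k + 1)) = n (Fin.last (k + 2)) := by rw [hX, Fin.snoc_last]
  have e3 : L 0 = n 0 := by rw [hL, Fin.cons_zero]
  have e4 : L (Fin.last (k + 1)) = s (Fin.last k) := by
    rw [hL, ← Fin.succ_last, Fin.cons_succ]
  rw [e1, e2, e3, e4]
  change _ = r 0 + s (Fin.last k) - n 0 - n (Fin.last (k + 2))
  ring

/-- The coordinates of a right comb tree expand into those of the left comb trees. -/
theorem hasSum_treeKernel_mul_leftTreeCoord (hq0 : 0 < q) (hq1 : q < 1) (x : ℤ)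
    (n : Fin (k + 2) → ℤ) (r : Fin k → ℤ) (a : Fin (k + 2) → ℕ) :
    HasSum (fun s => treeKernel q x n r s * leftTreeCoord q x s n a)
      (rightTreeCoord q x r n a) := by
  by_cases hd : labelShift n a (k + 2) = 0
  swap
  · simp only [leftTreeCoord, rightTreeCoord, if_neg hd, mul_zero]
    exact hasSum_zero
  set D := labelShift n a with hD
  set X : Fin (k + 1) → ℤ := Fin.snoc (α := fun _ => ℤ) r (n (Fin.last (k + 1))) with hX
  have hstep : ∀ j : Fin (k + 2), D (j + 1) = (a j - n j) - D j := labelShift_succ n a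
  have hD0 : D 0 = 0 := rfl
  have hD1 : D 1 = a 0 - n 0 := by
    have := hstep 0
    rw [Fin.val_zero, zero_add, hD0, sub_zero] at this
    exact this
  have hlast : D (k + 2) = (a (Fin.last (k + 1)) - n (Fin.last (k + 1))) - D (k + 1) :=
    hstep (Fin.last (k + 1))
  have h := hasSum_kernelProd_mul_leftProd hq0 hq1 x (a 0) (fun j => (a j.succ : ℤ))
    (fun j => X j + D (j + 1)) (by
      rw [hX, Fin.snoc_last, Fin.val_last, Fin.succ_last]
      change n (Fin.last (k + 1)) + D (k + 1) = a (Fin.last (k + 1))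
      omega)
  -- At a the actual inner nodes of the left comb are the labels s translated by the D (j + 2).
  rw [← (Equiv.addRight fun j : Fin k => D (j + 2)).hasSum_iff] at h
  refine h.of_eq (fun s => ?_) ?_
  · simp only [Function.comp_apply, Equiv.coe_addRight]
    have hL : ∀ i : Fin (k + 1),
        (Fin.cons (α := fun _ => ℤ) (a 0 : ℤ) (s + fun j : Fin k => D (j + 2)) :
          Fin (k + 1) → ℤ) i = (Fin.cons (α := fun _ => ℤ) (n 0) s : Fin (k + 1) → ℤ) i +
            D (i + 1) := fun i => by
      cases i using Fin.cases with
      | zero => rw [Fin.cons_zero, Fin.cons_zero, Fin.val_zero, zero_add, hD1]; ring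
      | succ i => rw [Fin.cons_succ, Fin.cons_succ, Fin.val_succ]; rfl
    have hS : ∀ i : Fin (k + 2),
        (Fin.cons (α := fun _ => ℤ) (a 0 : ℤ)
          (Fin.snoc (α := fun _ => ℤ) (s + fun j : Fin k => D (j + 2)) x) : Fin (k + 2) → ℤ) i =
          (Fin.cons (α := fun _ => ℤ) (n 0) (Fin.snoc (α := fun _ => ℤ) s x) :
            Fin (k + 2) → ℤ) i + D (i + 1) := fun i => by
      cases i using Fin.cases with
      | zero => rw [Fin.cons_zero, Fin.cons_zero, Fin.val_zero, zero_add, hD1]; ring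
      | succ i =>
        rw [Fin.cons_succ, Fin.cons_succ, Fin.val_succ]
        cases i using Fin.lastCases with
        | last => rw [Fin.snoc_last, Fin.snoc_last, Fin.val_last, hd, add_zero]
        | cast i => rw [Fin.snoc_castSucc, Fin.snoc_castSucc]; rfl
    congr 1
    -- The coefficient does not see a: the shifts cancel in the argument, and in the order D (j + 1)
    -- + D (j + 2) is compensated by replacing the leaf label with a.
    · rw [treeKernel, ← hX, kernelProd, kernelProd]
      refine Finset.prod_congr rfl fun j _ => ?_
      have h2 := hstep j.succ.castSucc
      simp only [Fin.val_castSucc, Fin.val_succ] at h2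
      simp only [hL, Fin.val_castSucc, Fin.val_succ]
      rw [Fin.succ_castSucc]
      congr 1 <;> omega
    · rw [leftTreeCoord, if_pos hd, leftProd]
      refine Finset.prod_congr rfl fun j _ => ?_
      simp only [hS, Fin.val_castSucc, Fin.val_succ]
      rfl
  · rw [rightTreeCoord, if_pos hd, rightProd, Fin.prod_univ_succ]
    simp only [Fin.castSucc_zero, Fin.cons_zero, Fin.cons_succ, ← Fin.succ_castSucc, Fin.val_zero,
      Fin.val_succ, Fin.val_castSucc, zero_add]
    change clebschGordan q (x + D 0) _ _ * _ = _
    rw [hD0, add_zero]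

lemma summable_rightTreeCoord_mul_self (hq0 : 0 < q) (hq1 : q < 1) {x : ℤ} (hx : 0 ≤ x)
    (n : Fin (k + 2) → ℤ) (r : Fin k → ℤ) :
    Summable fun a => rightTreeCoord q x r n a * rightTreeCoord q x r n a :=
  (hasSum_rightTreeCoord_mul hq0 hq1 hx n r r).summable

lemma summable_leftTreeCoord_mul_self (hq0 : 0 < q) (hq1 : q < 1) {x : ℤ} (hx : 0 ≤ x)
    (n : Fin (k + 2) → ℤ) (s : Fin k → ℤ) :
    Summable fun a => leftTreeCoord q x s n a * leftTreeCoord q x s n a :=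
  (hasSum_leftTreeCoord_mul hq0 hq1 hx n s s).summable

theorem orthonormal_rightTree (hq0 : 0 < q) (hq1 : q < 1) {x : ℤ} (hx : 0 ≤ x)
    (n : Fin (k + 2) → ℤ) : Orthonormal ℂ fun r : Fin k → ℤ => rightTree q x r n := by
  classical
  refine orthonormal_iff_ite.2 fun r r' => ?_
  rw [rightTree, rightTree, inner_toTensorL2 (summable_rightTreeCoord_mul_self hq0 hq1 hx n r)
    (summable_rightTreeCoord_mul_self hq0 hq1 hx n r')
    (hasSum_rightTreeCoord_mul hq0 hq1 hx n r r')]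
  split_ifs <;> simp

theorem orthonormal_leftTree (hq0 : 0 < q) (hq1 : q < 1) {x : ℤ} (hx : 0 ≤ x)
    (n : Fin (k + 2) → ℤ) : Orthonormal ℂ fun s : Fin k → ℤ => leftTree q x s n := by
  classical
  refine orthonormal_iff_ite.2 fun s s' => ?_
  rw [leftTree, leftTree, inner_toTensorL2 (summable_leftTreeCoord_mul_self hq0 hq1 hx n s)
    (summable_leftTreeCoord_mul_self hq0 hq1 hx n s')
    (hasSum_leftTreeCoord_mul hq0 hq1 hx n s s')]
  split_ifs <;> simp

/-- A right comb tree expands in norm into the left comb trees. -/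
theorem hasSum_treeKernel_smul_leftTree (hq0 : 0 < q) (hq1 : q < 1) {x : ℤ} (hx : 0 ≤ x)
    (n : Fin (k + 2) → ℤ) (r : Fin k → ℤ) :
    HasSum (fun s => (treeKernel q x n r s : ℂ) • leftTree q x s n) (rightTree q x r n) := by
  have hs : Summable fun s => (treeKernel q x n r s : ℂ) • leftTree q x s n := by
    -- The left trees are unit vectors, so absolute summability of the kernel suffices; the limit is
    -- then identified coordinatewise.
    refine Summable.of_norm_bounded (summable_kernelProd hq0 hq1 (fun j => x + n j.succ.castSucc)
      (Fin.snoc (α := fun _ => ℤ) r (n (Fin.last (k + 1)))) (n 0)) fun s => ?_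
    rw [norm_smul, (orthonormal_leftTree hq0 hq1 hx n).1 s, mul_one, Complex.norm_real]
    rfl
  have h := hs.hasSum
  have e : ∑' s, (treeKernel q x n r s : ℂ) • leftTree q x s n = rightTree q x r n := by
    refine lp.ext (funext fun a => ?_)
    have h1 := (lp.evalCLM ℂ (fun _ : Fin (k + 2) → ℕ => ℂ) 2 a).hasSum h
    have h2 := Complex.hasSum_ofReal.2 (hasSum_treeKernel_mul_leftTreeCoord hq0 hq1 x n r a)
    refine h1.unique ?_
    rw [rightTree, toTensorL2_apply (summable_rightTreeCoord_mul_self hq0 hq1 hx n r)]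
    have e2 : (fun s => ((treeKernel q x n r s * leftTreeCoord q x s n a : ℝ) : ℂ)) =
        fun s => lp.evalCLM ℂ (fun _ : Fin (k + 2) → ℕ => ℂ) 2 a
          ((treeKernel q x n r s : ℂ) • leftTree q x s n) := by
      funext s
      rw [map_smul, leftTree]
      change _ = _ • toTensorL2 (leftTreeCoord q x s n) a
      rw [toTensorL2_apply (summable_leftTreeCoord_mul_self hq0 hq1 hx n s)]
      simp
    rw [e2] at h2
    exact h2
  rwa [e] at h

theorem inner_leftTree_rightTree (hq0 : 0 < q) (hq1 : q < 1) {x : ℤ} (hx : 0 ≤ x)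
    (n : Fin (k + 2) → ℤ) (r s : Fin k → ℤ) :
    inner ℂ (leftTree q x s n) (rightTree q x r n) = (treeKernel q x n r s : ℂ) := by
  classical
  have h := (innerSL ℂ (leftTree q x s n)).hasSum (hasSum_treeKernel_smul_leftTree hq0 hq1 hx n r)
  refine h.unique ?_
  have ho := orthonormal_iff_ite.1 (orthonormal_leftTree hq0 hq1 hx n)
  have h1 := hasSum_single (f := fun s' => innerSL ℂ (leftTree q x s n)
    ((treeKernel q x n r s' : ℂ) • leftTree q x s' n)) s fun s' hs' => by
      rw [innerSL_apply_apply, inner_smul_right, ho, if_neg hs'.symm, mul_zero]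
  rwa [innerSL_apply_apply, inner_smul_right, ho, if_pos rfl, mul_one] at h1

theorem threeNJ_eq_treeKernel (hq0 : 0 < q) (hq1 : q < 1) (x : ℤ) (n : Fin (k + 2) → ℤ)
    (r s : Fin k → ℤ) :
    threeNJ q x n r s =
      (treeKernel q (max x 0) (shiftMiddle n (min x 0)) r s : ℂ) :=
  inner_leftTree_rightTree hq0 hq1 (le_max_right x 0) _ r s

/-- The kernel sees x only through the sums x + n_j at middle leaves, and max(x,0) + min(x,0) = x.
This makes the extension to x < 0 consistent. -/
lemma treeKernel_shiftMiddle (x : ℤ) (n : Fin (k + 2) → ℤ) (r s : Fin k → ℤ) :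
    treeKernel q (max x 0) (shiftMiddle n (min x 0)) r s = treeKernel q x n r s := by
  simp only [treeKernel, shiftMiddle_first, shiftMiddle_last, shiftMiddle_middle, ← add_assoc,
    max_add_min, add_zero]

end CouplingCoefficients

theorem mainTheorem5 (q : ℝ) (hq0 : 0 < q) (hq1 : q < 1) (k : ℕ) (hk : 1 ≤ k)
    (x : ℤ) (n : Fin (k + 2) → ℤ) :
    (0 ≤ x →
      Orthonormal ℂ (fun r : Fin k → ℤ => rightTree q x r n) ∧
      Orthonormal ℂ (fun s : Fin k → ℤ => leftTree q x s n) ∧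
      ∀ r : Fin k → ℤ,
        HasSum (fun s : Fin k → ℤ => threeNJ q x n r s • leftTree q x s n) (rightTree q x r n)) ∧
    ∀ r s : Fin k → ℤ,
      threeNJ q x n r s =
        (((-q) ^ (r ⟨0, by omega⟩ + s ⟨k - 1, by omega⟩ - n 0 - n (Fin.last (k + 1))) *
          multiQBessel (shiftMiddle n x) r s (q ^ 2) : ℝ) : ℂ) := by
  have h : ∀ r s : Fin k → ℤ, threeNJ q x n r s = (treeKernel q x n r s : ℂ) := fun r s => by
    rw [threeNJ_eq_treeKernel hq0 hq1, treeKernel_shiftMiddle]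
  refine ⟨fun hx => ⟨orthonormal_rightTree hq0 hq1 hx n, orthonormal_leftTree hq0 hq1 hx n,
    fun r => ?_⟩, fun r s => ?_⟩
  · simp only [h]
    exact hasSum_treeKernel_smul_leftTree hq0 hq1 hx n r
  · rw [h, treeKernel_eq hq0]
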